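/- Let $(p_n)_{n\ge 1}$ and $(q_n)_{n\ge 1}$ be sequences of non-negative integers, written $p=p_n$, $q=q_n$, such that, as $n\to\infty$, $$q\to\infty,\qquad \frac{q}{p}\to 0,\qquad \frac{pq}{n}\to\sigma\in(0,\infty).$$ For each $n$ let $\mathbf X_n=(g_{ij})$ be a $p\times q$ random matrix whose entries $g_{ij}$ are independent standard normal random variables, and let $\lambda_1,\dots,\lambda_q$ be the eigenvalues of $\mathbf X_n'\mathbf X_n$. Define $$L_n'=\Big(1-\frac pn\Big)^{-\frac12(n-p-q-1)q}\Big\{\prod_{i=1}^q\Big(1-\frac{\lambda_i}{n}\Big)\Big\}^{\frac{n-p-q-1}{2}}\exp\Big(\frac12\sum_{i=1}^q\lambda_i\Big).$$ (When $p<n$ and all $\lambda_i<n$, this is a positive number. For all other values, to have $\log L_n'$ defined everywhere, use the conventions $x^a=|x|^a\cos(\pi a)$ for $x<0$, $0^a=0$ for $a\neq0$, $0^0=1$, $\log x=\log|x|$ for $x<0$, $\log 0=0$, and division by zero gives $0$.) Then, as $n\to\infty$, $$\log L_n'-\frac{pq}{2}+\frac{pq(q+1)}{4(n-p)}\quad\text{converges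 weakly to}\quad N\Big(0,\frac{\sigma^2}{4}\Big).$$ -/

import Mathlib

open Filter MeasureTheory ProbabilityTheory

noncomputable section

/-- The eigenvalues `λ₁, …, λ_q` (with multiplicity) of the `q × q` symmetric matrix `Xᵀ X`. -/
def gramEigenvalues {p q : ℕ} (X : Matrix (Fin p) (Fin q) ℝ) : Fin q → ℝ :=
  Matrix.IsHermitian.eigenvalues (A := X.transpose * X)
    (by simpa using Matrix.isHermitian_conjTranspose_mul_self X)

/-- The eigenvalue factor
`L_n' = (1 - p/n)^{-(n-p-q-1)q/2} · (∏ᵢ (1 - λᵢ/n))^{(n-p-q-1)/2} · exp((1/2) ∑ᵢ λᵢ)`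
of a `p × q` matrix `X`, where `λ₁, …, λ_q` are the eigenvalues of `Xᵀ X`. Powers are real powers;
subtractions take place in `ℝ`. -/
def eigenvalueFactor (n : ℕ) {p q : ℕ} (X : Matrix (Fin p) (Fin q) ℝ) : ℝ :=
  (1 - (p : ℝ) / n) ^ (-(1 / 2 : ℝ) * ((n : ℝ) - p - q - 1) * q)
    * (∏ i, (1 - gramEigenvalues X i / n)) ^ (((n : ℝ) - p - q - 1) / 2)
    * Real.exp ((1 / 2 : ℝ) * ∑ i, gramEigenvalues X i)

/-- The entries of the random matrix `X` are independent standard normal random variables. -/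
structure IsStandardGaussianMatrix {Ω : Type*} [MeasurableSpace Ω] {p q : ℕ}
    (X : Ω → Matrix (Fin p) (Fin q) ℝ) (P : Measure Ω) : Prop where
  hasLaw : ∀ i j, HasLaw (fun ω => X ω i j) (gaussianReal 0 1) P
  indep : iIndepFun (fun (ij : Fin p × Fin q) ω => X ω ij.1 ij.2) P

end

/-!
Let `A = Xᵀ X - p I` be the centred Gram matrix, `T_r = tr A ^ r = ∑ᵢ (λᵢ - p) ^ r`,
`c = p q (q + 1)` and `N = n - p`. On the event `T_2 ≤ N² / 4` every `|λᵢ - p|` is at most `N / 2`,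
and a second-order Taylor expansion of `log (1 - λᵢ / n)` around `λᵢ = p` gives
(`abs_centredLogFactor_add_le`)

  `log L' - pq / 2 + c / (4N) = -(T_2 - c) / (4N) + error`,

where the error is bounded through `|T_1|`, `T_2` and `∑ᵢ |λᵢ - p|³`. The cubic sum is dominated by
`T_2` and `T_4`, so that only moments of `T_1`, `T_2`, `T_4` are needed, and no information on the
extreme eigenvalues.

The central limit theorem for `(T_2 - c) / N` comes from Gaussian integration by parts. Applied to
the matrix field `X A` with the weight `f (T_2)` it gives the exact identity
(`integral_gramPowerTrace_two_sub_mul`)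

  `E[(T_2 - c) f(T_2)] = (q + 1) E[T_1 f(T_2)] + 4 E[(p T_2 + T_3) f'(T_2)]`.

With `f = 1` it shows `E T_2 = c`, with `f(y) = y - c` it bounds the variance of `T_2`. For bounded
`f` and `f'` it says that `T_2` satisfies, up to small errors, the Stein identity of a Gaussian of
mean `c` and variance `4 p c` (`abs_integral_stein_le`): `p T_2` concentrates around `p c`, and
`T_1`, `T_3` are negligible. The bound on `T_3` uses `E T_4 = O(p² q³)`, which is integration by
parts for the field `X A³` (`integral_gramPowerTrace_four`).

Taking `f` to be a sine or a cosine turns the approximate Stein identity into the approximate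
differential equation `φ' = -v t φ` for the characteristic function of `(T_2 - c) / N`, with
`v = 4 p c / N² → 4 σ²` (`norm_integral_cexp_sub_le`). All errors vanish in the limit because
`pq / n → σ` and `q / p → 0` force `p / n → 0` and `q² / n → 0`, and Lévy's continuity theorem
concludes.
-/

open scoped ENNReal NNReal Matrix

/-! ### Random variables with all moments -/

/-- The real random variable `F` lies in `L^r` for every finite exponent `r`. -/
def HasAllMoments {Ω : Type*} [MeasurableSpace Ω] (F : Ω → ℝ) (μ : Measure Ω) : Prop :=
  ∀ r : ℝ≥0, MemLp F r μ

namespace HasAllMoments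

variable {Ω : Type*} [MeasurableSpace Ω] {μ : Measure Ω} {F G : Ω → ℝ}

lemma integrable (hF : HasAllMoments F μ) : Integrable F μ :=
  memLp_one_iff_integrable.1 (by simpa using hF 1)

lemma const [IsFiniteMeasure μ] (c : ℝ) : HasAllMoments (fun _ => c) μ :=
  fun _ => memLp_const c

lemma add (hF : HasAllMoments F μ) (hG : HasAllMoments G μ) :
    HasAllMoments (fun x => F x + G x) μ := fun r => (hF r).add (hG r)

lemma sub (hF : HasAllMoments F μ) (hG : HasAllMoments G μ) :
    HasAllMoments (fun x => F x - G x) μ := fun r => (hF r).sub (hG r)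

lemma const_mul (hF : HasAllMoments F μ) (c : ℝ) : HasAllMoments (fun x => c * F x) μ :=
  fun r => (hF r).const_mul c

lemma sum {ι : Type*} (s : Finset ι) {F : ι → Ω → ℝ} (hF : ∀ i ∈ s, HasAllMoments (F i) μ) :
    HasAllMoments (fun x => ∑ i ∈ s, F i x) μ := fun r => memLp_finsetSum s fun i hi => hF i hi r

lemma mul (hF : HasAllMoments F μ) (hG : HasAllMoments G μ) :
    HasAllMoments (fun x => F x * G x) μ := by
  intro r
  have h : ENNReal.HolderTriple ((2 * r : ℝ≥0) : ℝ≥0∞) ((2 * r : ℝ≥0) : ℝ≥0∞) (r : ℝ≥0∞) := by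
    constructor
    rw [ENNReal.coe_mul, ENNReal.mul_inv (by simp) (by simp), ← add_mul]
    simp [ENNReal.inv_two_add_inv_two]
  exact (hG (2 * r)).mul (hF (2 * r))

lemma pow [IsFiniteMeasure μ] (hF : HasAllMoments F μ) (k : ℕ) :
    HasAllMoments (fun x => F x ^ k) μ := by
  induction k with
  | zero => simpa using const 1
  | succ k ih => simpa only [pow_succ] using ih.mul hF

lemma abs (hF : HasAllMoments F μ) : HasAllMoments (fun x => |F x|) μ := fun r => (hF r).abs

lemma of_bounded [IsFiniteMeasure μ] (hm : AEStronglyMeasurable F μ) (C : ℝ)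
    (hC : ∀ x, |F x| ≤ C) : HasAllMoments F μ :=
  fun _ => MemLp.of_bound hm C (ae_of_all _ hC)

end HasAllMoments

/-! ### Gaussian integration by parts -/

lemma hasDerivAt_gaussianPDFReal_zero_one (t : ℝ) :
    HasDerivAt (gaussianPDFReal 0 1) (-(t * gaussianPDFReal 0 1 t)) t := by
  have h : HasDerivAt (fun x : ℝ => (√(2 * Real.pi * (1 : ℝ≥0)))⁻¹ *
      Real.exp (-(x - 0) ^ 2 / (2 * (1 : ℝ≥0)))) _ t :=
    ((((((hasDerivAt_id t).sub_const 0).pow 2).neg).div_const _).exp).const_mul _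
  convert! h using 1
  simp [gaussianPDFReal]
  ring

/-- Stein's identity for the standard Gaussian measure on `ℝ`. -/
lemma integral_id_mul_gaussianReal {f f' : ℝ → ℝ} (hd : ∀ t, HasDerivAt f (f' t) t)
    (h0 : Integrable f (gaussianReal 0 1)) (h1 : Integrable (fun t => t * f t) (gaussianReal 0 1))
    (h2 : Integrable f' (gaussianReal 0 1)) :
    ∫ t, t * f t ∂gaussianReal 0 1 = ∫ t, f' t ∂gaussianReal 0 1 := by
  -- integrability against the Gaussian is Lebesgue integrability after multiplying by the density
  have key : ∀ g : ℝ → ℝ, Integrable g (gaussianReal 0 1) →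
      Integrable (fun t => g t * gaussianPDFReal 0 1 t) := by
    intro g hg
    rw [gaussianReal_of_var_ne_zero _ one_ne_zero,
      integrable_withDensity_iff (measurable_gaussianPDF 0 1)
        (ae_of_all _ fun _ => gaussianPDF_lt_top)] at hg
    simpa [toReal_gaussianPDF] using hg
  rw [integral_gaussianReal_eq_integral_smul one_ne_zero,
    integral_gaussianReal_eq_integral_smul one_ne_zero]
  have := integral_mul_deriv_eq_deriv_mul_of_integrable (u := f) (u' := f')
    (v := gaussianPDFReal 0 1) (v' := fun t => -(t * gaussianPDFReal 0 1 t))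
    (fun t _ => hd t) (fun t _ => hasDerivAt_gaussianPDFReal_zero_one t)
    (by
      refine (key _ h1).neg.congr (ae_of_all _ fun t => ?_)
      simp only [Pi.neg_apply, Pi.mul_apply]; ring) (key _ h2) (key _ h0)
  calc ∫ t, gaussianPDFReal 0 1 t • (t * f t)
      = - ∫ t, f t * -(t * gaussianPDFReal 0 1 t) := by
        rw [← integral_neg]; congr 1; ext t; simp only [smul_eq_mul]; ring
    _ = ∫ t, gaussianPDFReal 0 1 t • f' t := by
        rw [this, neg_neg]; congr 1; ext t; simp only [smul_eq_mul]; ring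

/-- Resampling one coordinate leaves a product of standard Gaussian measures invariant. -/
lemma measurePreserving_update_gaussian {ι : Type*} [Fintype ι] [DecidableEq ι] (k : ι) :
    MeasurePreserving (fun z : (ι → ℝ) × ℝ => Function.update z.1 k z.2)
      ((Measure.pi fun _ : ι => gaussianReal 0 1).prod (gaussianReal 0 1))
      (Measure.pi fun _ : ι => gaussianReal 0 1) := by
  have hm : Measurable (fun z : (ι → ℝ) × ℝ => Function.update z.1 k z.2) := by
    refine measurable_pi_lambda _ fun i => ?_
    by_cases h : i = k
    · subst h; simpa using measurable_snd
    · simp only [Function.update_of_ne h]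
      exact (measurable_pi_apply i).comp measurable_fst
  refine ⟨hm, (Measure.pi_eq fun s hs => ?_).symm⟩
  rw [Measure.map_apply hm (MeasurableSet.univ_pi hs)]
  have : (fun z : (ι → ℝ) × ℝ => Function.update z.1 k z.2) ⁻¹' Set.univ.pi s =
      (Set.univ.pi (Function.update s k Set.univ)) ×ˢ s k := by
    ext z
    simp only [Set.mem_preimage, Set.mem_univ_pi, Set.mem_prod]
    constructor
    · intro h
      refine ⟨fun i => ?_, by simpa using h k⟩
      by_cases hi : i = k
      · subst hi; simp
      · simpa [Function.update_of_ne hi] using h i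
    · rintro ⟨h1, h2⟩ i
      by_cases hi : i = k
      · subst hi; simpa using h2
      · simpa [Function.update_of_ne hi] using h1 i
  rw [this, Measure.prod_prod, Measure.pi_pi,
    ← Finset.mul_prod_erase _ _ (Finset.mem_univ k),
    ← Finset.mul_prod_erase Finset.univ (fun i => gaussianReal 0 1 (s i)) (Finset.mem_univ k)]
  simp only [Function.update_self, measure_univ, one_mul]
  rw [mul_comm]
  congr 1
  refine Finset.prod_congr rfl fun i hi => ?_
  rw [Function.update_of_ne (Finset.ne_of_mem_erase hi)]

/-- Stein's identity in one coordinate of a standard Gaussian vector. -/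
lemma integral_coord_mul_gaussian {ι : Type*} [Fintype ι] [DecidableEq ι] (k : ι)
    {F F' : (ι → ℝ) → ℝ}
    (hd : ∀ x, HasDerivAt (fun t => F (Function.update x k t)) (F' x) (x k))
    (h0 : Integrable F (Measure.pi fun _ : ι => gaussianReal 0 1))
    (h1 : Integrable (fun x => x k * F x) (Measure.pi fun _ : ι => gaussianReal 0 1))
    (h2 : Integrable F' (Measure.pi fun _ : ι => gaussianReal 0 1)) :
    ∫ x, x k * F x ∂(Measure.pi fun _ : ι => gaussianReal 0 1)
      = ∫ x, F' x ∂(Measure.pi fun _ : ι => gaussianReal 0 1) := by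
  have hmp := measurePreserving_update_gaussian k
  -- resampling the coordinate `k` reduces the claim to the one-dimensional identity on slices
  have key : ∀ G : (ι → ℝ) → ℝ, Integrable G (Measure.pi fun _ : ι => gaussianReal 0 1) →
      Integrable (fun z : (ι → ℝ) × ℝ => G (Function.update z.1 k z.2))
        ((Measure.pi fun _ : ι => gaussianReal 0 1).prod (gaussianReal 0 1)) ∧
      ∫ x, G x ∂(Measure.pi fun _ : ι => gaussianReal 0 1) =
        ∫ x, ∫ t, G (Function.update x k t) ∂gaussianReal 0 1
          ∂(Measure.pi fun _ : ι => gaussianReal 0 1) := by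
    intro G hG
    have hi : Integrable (fun z : (ι → ℝ) × ℝ => G (Function.update z.1 k z.2))
        ((Measure.pi fun _ : ι => gaussianReal 0 1).prod (gaussianReal 0 1)) :=
      hmp.integrable_comp_of_integrable hG
    refine ⟨hi, ?_⟩
    rw [← integral_prod _ hi]
    conv_lhs => rw [← hmp.map_eq]
    rw [integral_map hmp.measurable.aemeasurable]
    rw [hmp.map_eq]
    exact hG.aestronglyMeasurable
  rw [(key _ h1).2, (key _ h2).2]
  refine integral_congr_ae ?_
  filter_upwards [(key _ h0).1.prod_right_ae, (key _ h1).1.prod_right_ae,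
    (key _ h2).1.prod_right_ae] with x e0 e1 e2
  simp only [Function.update_self] at e1 ⊢
  exact integral_id_mul_gaussianReal
    (fun t => by simpa using hd (Function.update x k t)) e0 e1 e2

/-! ### Entrywise calculus for random matrices -/

/-- Every entry of the random matrix `B` has all moments. -/
def MatrixHasAllMoments {Ω m n : Type*} [MeasurableSpace Ω] (B : Ω → Matrix m n ℝ)
    (μ : Measure Ω) : Prop := ∀ i j, HasAllMoments (fun x => B x i j) μ

namespace MatrixHasAllMoments

variable {Ω : Type*} [MeasurableSpace Ω] {μ : Measure Ω} {l m n : Type*}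

lemma const [IsFiniteMeasure μ] (C : Matrix m n ℝ) : MatrixHasAllMoments (fun _ : Ω => C) μ :=
  fun _ _ => .const _

lemma add {B C : Ω → Matrix m n ℝ} (hB : MatrixHasAllMoments B μ) (hC : MatrixHasAllMoments C μ) :
    MatrixHasAllMoments (fun x => B x + C x) μ := fun i j => (hB i j).add (hC i j)

lemma sub {B C : Ω → Matrix m n ℝ} (hB : MatrixHasAllMoments B μ) (hC : MatrixHasAllMoments C μ) :
    MatrixHasAllMoments (fun x => B x - C x) μ := fun i j => (hB i j).sub (hC i j)

lemma transpose {B : Ω → Matrix m n ℝ} (hB : MatrixHasAllMoments B μ) :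
    MatrixHasAllMoments (fun x => (B x)ᵀ) μ := fun i j => hB j i

variable [Fintype m]

lemma mul {B : Ω → Matrix l m ℝ} {C : Ω → Matrix m n ℝ}
    (hB : MatrixHasAllMoments B μ) (hC : MatrixHasAllMoments C μ) :
    MatrixHasAllMoments (fun x => B x * C x) μ := by
  intro i j
  simp only [Matrix.mul_apply]
  exact .sum _ fun k _ => (hB i k).mul (hC k j)

lemma pow [IsFiniteMeasure μ] [DecidableEq m] {B : Ω → Matrix m m ℝ}
    (hB : MatrixHasAllMoments B μ) (r : ℕ) : MatrixHasAllMoments (fun x => B x ^ r) μ := by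
  induction r with
  | zero => simpa using const 1
  | succ r ih => simpa only [pow_succ] using ih.mul hB

lemma trace {B : Ω → Matrix m m ℝ} (hB : MatrixHasAllMoments B μ) :
    HasAllMoments (fun x => (B x).trace) μ := .sum _ fun i _ => hB i i

end MatrixHasAllMoments

/-- Entrywise derivative of a curve of matrices. -/
def MatrixHasDerivAt {m n : Type*} (B : ℝ → Matrix m n ℝ) (B' : Matrix m n ℝ) (t : ℝ) : Prop :=
  ∀ i j, HasDerivAt (fun s => B s i j) (B' i j) t

namespace MatrixHasDerivAt

variable {l m n : Type*} {t : ℝ}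

lemma transpose {B : ℝ → Matrix m n ℝ} {B' : Matrix m n ℝ} (hB : MatrixHasDerivAt B B' t) :
    MatrixHasDerivAt (fun s => (B s)ᵀ) B'ᵀ t := fun i j => hB j i

lemma sub_const {B : ℝ → Matrix m n ℝ} {B' : Matrix m n ℝ} (hB : MatrixHasDerivAt B B' t)
    (C : Matrix m n ℝ) : MatrixHasDerivAt (fun s => B s - C) B' t :=
  fun i j => (hB i j).sub_const _

variable [Fintype m]

lemma mul {B : ℝ → Matrix l m ℝ} {B' : Matrix l m ℝ} {C : ℝ → Matrix m n ℝ} {C' : Matrix m n ℝ}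
    (hB : MatrixHasDerivAt B B' t) (hC : MatrixHasDerivAt C C' t) :
    MatrixHasDerivAt (fun s => B s * C s) (B' * C t + B t * C') t := by
  intro i j
  simp only [Matrix.mul_apply, Matrix.add_apply, ← Finset.sum_add_distrib]
  exact HasDerivAt.fun_sum fun k _ => (hB i k).mul (hC k j)

lemma trace {B : ℝ → Matrix m m ℝ} {B' : Matrix m m ℝ} (hB : MatrixHasDerivAt B B' t) :
    HasDerivAt (fun s => (B s).trace) B'.trace t := HasDerivAt.fun_sum fun i _ => hB i i

end MatrixHasDerivAt

section Contractions

variable {m n : Type*} [Fintype m] [Fintype n] [DecidableEq m] [DecidableEq n]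

/-- Contracting a matrix unit with its own position factors into two traces. -/
lemma sum_mul_single_mul (Y : Matrix m m ℝ) (Z : Matrix n n ℝ) :
    ∑ k : m, ∑ i : n, (Y * Matrix.single k i (1 : ℝ) * Z) k i = Y.trace * Z.trace := by
  simp only [Matrix.trace, Finset.sum_mul_sum, Matrix.diag_apply]
  refine Finset.sum_congr rfl fun k _ => Finset.sum_congr rfl fun i _ => ?_
  simp [Matrix.mul_apply, Matrix.single_apply, ite_and]

/-- Contracting a transposed matrix unit with the position of the unit gives a single trace. -/
lemma sum_mul_single_transpose_mul (Y Z : Matrix m n ℝ) :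
    ∑ k : m, ∑ i : n, (Y * (Matrix.single k i (1 : ℝ))ᵀ * Z) k i = (Yᵀ * Z).trace := by
  rw [Finset.sum_comm]
  simp only [Matrix.trace, Matrix.diag_apply, Matrix.mul_apply (M := Yᵀ), Matrix.transpose_apply]
  refine Finset.sum_congr rfl fun k _ => Finset.sum_congr rfl fun i _ => ?_
  simp [Matrix.mul_apply, Matrix.single_apply, ite_and]

lemma trace_mul_single_transpose_mul (Y : Matrix n n ℝ) (Z : Matrix m n ℝ) (k : m) (i : n) :
    (Y * ((Matrix.single k i (1 : ℝ))ᵀ * Z)).trace = (Z * Y) k i := by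
  rw [← Matrix.mul_assoc, Matrix.trace_mul_comm, ← Matrix.mul_assoc, Matrix.transpose_single,
    Matrix.trace_mul_single]
  simp

lemma trace_mul_transpose_mul_single (Y : Matrix n n ℝ) (Z : Matrix m n ℝ) (k : m) (i : n) :
    (Y * (Zᵀ * Matrix.single k i (1 : ℝ))).trace = (Z * Yᵀ) k i := by
  rw [← Matrix.mul_assoc, Matrix.trace_mul_single]
  simp [Matrix.mul_apply, mul_comm]

end Contractions

/-! ### The Gaussian data matrix and its centred Gram matrix -/

section Gram

variable {p q : ℕ}

/-- The `p × q` matrix with entries the coordinates of `x`. -/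
def dataMatrix (x : Fin p × Fin q → ℝ) : Matrix (Fin p) (Fin q) ℝ := Matrix.of fun i j => x (i, j)

/-- The centred Gram matrix `Xᵀ X - p I` of the data matrix. -/
def centredGram (x : Fin p × Fin q → ℝ) : Matrix (Fin q) (Fin q) ℝ :=
  (dataMatrix x)ᵀ * dataMatrix x - (p : ℝ) • 1

/-- The trace of the `r`-th power of the centred Gram matrix. -/
def gramPowerTrace (r : ℕ) (x : Fin p × Fin q → ℝ) : ℝ := (centredGram x ^ r).trace

/-- The law of a `p × q` matrix with independent standard Gaussian entries. -/
noncomputable def gaussianMatrix (p q : ℕ) : Measure (Fin p × Fin q → ℝ) :=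
  Measure.pi fun _ => gaussianReal 0 1

instance : IsProbabilityMeasure (gaussianMatrix p q) := by
  unfold gaussianMatrix; infer_instance

lemma hasAllMoments_coord (k : Fin p × Fin q) :
    HasAllMoments (fun x => x k) (gaussianMatrix p q) := by
  intro r
  have := (memLp_id_gaussianReal (μ := 0) (v := 1) r).comp_measurePreserving
    (measurePreserving_eval (fun _ : Fin p × Fin q => gaussianReal 0 1) k)
  exact this

lemma hasAllMoments_dataMatrix : MatrixHasAllMoments dataMatrix (gaussianMatrix p q) :=
  fun i j => hasAllMoments_coord (i, j)

lemma hasAllMoments_centredGram : MatrixHasAllMoments centredGram (gaussianMatrix p q) :=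
  (hasAllMoments_dataMatrix.transpose.mul hasAllMoments_dataMatrix).sub (.const _)

lemma hasAllMoments_gramPowerTrace (r : ℕ) :
    HasAllMoments (gramPowerTrace r) (gaussianMatrix p q) :=
  (hasAllMoments_centredGram.pow r).trace

lemma isSymm_centredGram (x : Fin p × Fin q → ℝ) : (centredGram x)ᵀ = centredGram x := by
  simp [centredGram]

lemma transpose_mul_self_eq (x : Fin p × Fin q → ℝ) :
    (dataMatrix x)ᵀ * dataMatrix x = centredGram x + (p : ℝ) • 1 := by
  simp [centredGram]

lemma dataMatrix_hasDerivAt (x : Fin p × Fin q → ℝ) (k : Fin p) (i : Fin q) :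
    MatrixHasDerivAt (fun t => dataMatrix (Function.update x (k, i) t)) (Matrix.single k i (1 : ℝ))
      (x (k, i)) := by
  intro a b
  have := hasDerivAt_pi.1 (hasDerivAt_update x (k, i) (x (k, i))) (a, b)
  convert! this using 1
  simp [Matrix.single_apply, Pi.single_apply, Prod.ext_iff, eq_comm]

/-- The partial derivative of `Xᵀ X - p I` in the entry `(k, i)` is `Eᵀ X + Xᵀ E`, where `E` is the
matrix unit at `(k, i)`. -/
lemma centredGram_hasDerivAt (x : Fin p × Fin q → ℝ) (k : Fin p) (i : Fin q) :
    MatrixHasDerivAt (fun t => centredGram (Function.update x (k, i) t))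
      ((Matrix.single k i (1 : ℝ))ᵀ * dataMatrix x + (dataMatrix x)ᵀ * Matrix.single k i (1 : ℝ))
      (x (k, i)) := by
  have h := dataMatrix_hasDerivAt x k i
  have h' := (h.transpose.mul h).sub_const ((p : ℝ) • (1 : Matrix (Fin q) (Fin q) ℝ))
  rwa [Function.update_eq_self] at h'

lemma gramPowerTrace_one_hasDerivAt (x : Fin p × Fin q → ℝ) (k : Fin p) (i : Fin q) :
    HasDerivAt (fun t => gramPowerTrace 1 (Function.update x (k, i) t))
      (2 * dataMatrix x k i) (x (k, i)) := by
  have h := (centredGram_hasDerivAt x k i).trace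
  simp only [gramPowerTrace, pow_one]
  convert h using 1
  have h1 := trace_mul_single_transpose_mul 1 (dataMatrix x) k i
  have h2 := trace_mul_transpose_mul_single 1 (dataMatrix x) k i
  rw [Matrix.trace_add]
  simp only [Matrix.one_mul, Matrix.mul_one, Matrix.transpose_one] at h1 h2
  rw [h1, h2]; ring

lemma gramPowerTrace_two_hasDerivAt (x : Fin p × Fin q → ℝ) (k : Fin p) (i : Fin q) :
    HasDerivAt (fun t => gramPowerTrace 2 (Function.update x (k, i) t))
      (4 * (dataMatrix x * centredGram x) k i) (x (k, i)) := by
  have h0 := centredGram_hasDerivAt x k i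
  have h := (h0.mul h0).trace
  simp only [gramPowerTrace, pow_two]
  convert h using 1
  simp only [Function.update_eq_self]
  rw [Matrix.trace_add, Matrix.trace_mul_comm, Matrix.mul_add, Matrix.trace_add,
    trace_mul_single_transpose_mul, trace_mul_transpose_mul_single, isSymm_centredGram]
  ring

/-- Gaussian integration by parts for the divergence of a matrix field `Φ` against a scalar
weight `g`; `Φ' k i` and `g' k i` are the partial derivatives in the entry `(k, i)`. -/
lemma integral_divergence {Φ : (Fin p × Fin q → ℝ) → Matrix (Fin p) (Fin q) ℝ}
    {Φ' : Fin p → Fin q → (Fin p × Fin q → ℝ) → Matrix (Fin p) (Fin q) ℝ}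
    {g : (Fin p × Fin q → ℝ) → ℝ} {g' : Fin p → Fin q → (Fin p × Fin q → ℝ) → ℝ}
    (hΦ : MatrixHasAllMoments Φ (gaussianMatrix p q))
    (hΦ' : ∀ k i, MatrixHasAllMoments (Φ' k i) (gaussianMatrix p q))
    (hg : HasAllMoments g (gaussianMatrix p q))
    (hg' : ∀ k i, HasAllMoments (g' k i) (gaussianMatrix p q))
    (hdΦ : ∀ x k i, MatrixHasDerivAt (fun t => Φ (Function.update x (k, i) t)) (Φ' k i x)
      (x (k, i)))
    (hdg : ∀ x k i, HasDerivAt (fun t => g (Function.update x (k, i) t)) (g' k i x) (x (k, i))) :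
    ∫ x, ((dataMatrix x)ᵀ * Φ x).trace * g x ∂gaussianMatrix p q =
      ∫ x, ((∑ k, ∑ i, Φ' k i x k i) * g x + ∑ k, ∑ i, Φ x k i * g' k i x)
        ∂gaussianMatrix p q := by
  have hcoord : ∀ k i, ∫ x, x (k, i) * (Φ x k i * g x) ∂gaussianMatrix p q =
      ∫ x, (Φ' k i x k i * g x + Φ x k i * g' k i x) ∂gaussianMatrix p q := by
    intro k i
    refine integral_coord_mul_gaussian (k, i) (F := fun x => Φ x k i * g x) (fun x => ?_)
      ((hΦ k i).mul hg).integrable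
      ((hasAllMoments_coord (k, i)).mul ((hΦ k i).mul hg)).integrable
      (((hΦ' k i k i).mul hg).add ((hΦ k i).mul (hg' k i))).integrable
    simpa only [Function.update_eq_self] using (hdΦ x k i k i).fun_mul (hdg x k i)
  calc ∫ x, ((dataMatrix x)ᵀ * Φ x).trace * g x ∂gaussianMatrix p q
      = ∫ x, ∑ k, ∑ i, x (k, i) * (Φ x k i * g x) ∂gaussianMatrix p q := by
        congr 1; ext x
        simp only [Matrix.trace, Matrix.diag_apply, Matrix.mul_apply, Finset.sum_mul,
          Matrix.transpose_apply, dataMatrix, Matrix.of_apply]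
        rw [Finset.sum_comm]
        simp only [mul_assoc]
    _ = ∑ k, ∑ i, ∫ x, x (k, i) * (Φ x k i * g x) ∂gaussianMatrix p q := by
        rw [integral_finsetSum]
        · refine Finset.sum_congr rfl fun k _ => integral_finsetSum _ fun i _ => ?_
          exact ((hasAllMoments_coord (k, i)).mul ((hΦ k i).mul hg)).integrable
        · exact fun k _ => integrable_finsetSum _ fun i _ =>
            ((hasAllMoments_coord (k, i)).mul ((hΦ k i).mul hg)).integrable
    _ = ∑ k, ∑ i, ∫ x, (Φ' k i x k i * g x + Φ x k i * g' k i x) ∂gaussianMatrix p q := by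
        simp only [hcoord]
    _ = ∫ x, ∑ k, ∑ i, (Φ' k i x k i * g x + Φ x k i * g' k i x) ∂gaussianMatrix p q := by
        rw [integral_finsetSum]
        · refine Finset.sum_congr rfl fun k _ => (integral_finsetSum _ fun i _ => ?_).symm
          exact (((hΦ' k i k i).mul hg).add ((hΦ k i).mul (hg' k i))).integrable
        · exact fun k _ => integrable_finsetSum _ fun i _ =>
            (((hΦ' k i k i).mul hg).add ((hΦ k i).mul (hg' k i))).integrable
    _ = _ := by
        congr 1; ext x
        simp only [Finset.sum_add_distrib, Finset.sum_mul]

end Gram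

/-! ### Moment identities for the centred Gram matrix -/

section GramMoments

variable {p q : ℕ}

lemma trace_gram_mul (x : Fin p × Fin q → ℝ) (B : Matrix (Fin q) (Fin q) ℝ) :
    ((dataMatrix x)ᵀ * dataMatrix x * B).trace = (centredGram x * B).trace + p * B.trace := by
  rw [transpose_mul_self_eq, Matrix.add_mul, Matrix.trace_add]
  simp

lemma trace_gram (x : Fin p × Fin q → ℝ) :
    ((dataMatrix x)ᵀ * dataMatrix x).trace = gramPowerTrace 1 x + p * q := by
  simpa [gramPowerTrace] using trace_gram_mul x 1

/-- Integration by parts for the field `X`. -/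
lemma integral_trace_gram_mul {g : (Fin p × Fin q → ℝ) → ℝ}
    {g' : Fin p → Fin q → (Fin p × Fin q → ℝ) → ℝ}
    (hg : HasAllMoments g (gaussianMatrix p q))
    (hg' : ∀ k i, HasAllMoments (g' k i) (gaussianMatrix p q))
    (hdg : ∀ x k i, HasDerivAt (fun t => g (Function.update x (k, i) t)) (g' k i x) (x (k, i))) :
    ∫ x, (gramPowerTrace 1 x + p * q) * g x ∂gaussianMatrix p q =
      ∫ x, ((p * q : ℝ) * g x + ∑ k, ∑ i, dataMatrix x k i * g' k i x) ∂gaussianMatrix p q := by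
  have h := integral_divergence (p := p) (q := q) (Φ := dataMatrix)
    (Φ' := fun k i _ => Matrix.single k i (1 : ℝ)) hasAllMoments_dataMatrix (fun k i => .const _) hg
    hg' dataMatrix_hasDerivAt hdg
  simpa [trace_gram] using h

lemma integral_gramPowerTrace_one :
    ∫ x, gramPowerTrace 1 x ∂gaussianMatrix p q = 0 := by
  have h := integral_trace_gram_mul (p := p) (q := q) (g := fun _ => 1) (g' := fun _ _ _ => 0)
    (.const 1) (fun _ _ => .const 0) (fun x k i => hasDerivAt_const _ _)
  have hi := (hasAllMoments_gramPowerTrace (p := p) (q := q) 1).integrable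
  simp only [mul_one, mul_zero, Finset.sum_const_zero, add_zero] at h
  rw [integral_add hi (integrable_const _)] at h
  simpa using h

/-- Integration by parts for the field `X` with the weight `tr A`. -/
lemma integral_gramPowerTrace_one_sq :
    ∫ x, gramPowerTrace 1 x ^ 2 ∂gaussianMatrix p q = 2 * p * q := by
  have h := integral_trace_gram_mul (p := p) (q := q) (g := gramPowerTrace 1)
    (g' := fun k i x => 2 * dataMatrix x k i)
    (hasAllMoments_gramPowerTrace 1) (fun k i => (hasAllMoments_dataMatrix k i).const_mul 2)
    gramPowerTrace_one_hasDerivAt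
  have hs : ∀ x : Fin p × Fin q → ℝ, ∑ k, ∑ i, dataMatrix x k i * (2 * dataMatrix x k i) =
      2 * (gramPowerTrace 1 x + p * q) := by
    intro x
    rw [← trace_gram, Finset.sum_comm]
    simp only [Matrix.trace, Matrix.diag_apply, Matrix.mul_apply, Matrix.transpose_apply,
      Finset.mul_sum]
    exact Finset.sum_congr rfl fun _ _ => Finset.sum_congr rfl fun _ _ => by ring
  have hT := hasAllMoments_gramPowerTrace (p := p) (q := q) 1
  simp only [hs] at h
  have e1 : ∫ x, (gramPowerTrace 1 x + p * q) * gramPowerTrace 1 x ∂gaussianMatrix p q =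
      ∫ x, gramPowerTrace 1 x ^ 2 ∂gaussianMatrix p q := by
    have : ∀ x : Fin p × Fin q → ℝ, (gramPowerTrace 1 x + p * q) * gramPowerTrace 1 x =
      gramPowerTrace 1 x ^ 2 + p * q * gramPowerTrace 1 x := fun x => by ring
    simp only [this]
    rw [integral_add (hT.pow 2).integrable (hT.const_mul _).integrable, integral_const_mul,
      integral_gramPowerTrace_one]
    simp
  have e2 : ∫ x, ((p * q : ℝ) * gramPowerTrace 1 x + 2 * (gramPowerTrace 1 x + p * q))
      ∂gaussianMatrix p q = 2 * p * q := by
    have : ∀ x : Fin p × Fin q → ℝ,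
      (p * q : ℝ) * gramPowerTrace 1 x + 2 * (gramPowerTrace 1 x + p * q) =
      (p * q + 2 : ℝ) * gramPowerTrace 1 x + 2 * p * q := fun x => by ring
    simp only [this]
    rw [integral_add (hT.const_mul _).integrable (integrable_const _), integral_const_mul,
      integral_gramPowerTrace_one]
    simp
  rw [← e1, h, e2]

lemma gramPowerTrace_two_eq (x : Fin p × Fin q → ℝ) :
    gramPowerTrace 2 x = (centredGram x * centredGram x).trace := by
  rw [gramPowerTrace, pow_two]

lemma gramPowerTrace_three_eq (x : Fin p × Fin q → ℝ) :
    gramPowerTrace 3 x = (centredGram x * centredGram x * centredGram x).trace := by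
  rw [gramPowerTrace, pow_succ, pow_two]

lemma gramPowerTrace_four_eq (x : Fin p × Fin q → ℝ) :
    gramPowerTrace 4 x = (centredGram x * centredGram x * centredGram x * centredGram x).trace := by
  rw [gramPowerTrace, pow_succ, pow_succ, pow_two]

/-- The Stein-type identity for `tr A²`, where `A` is the centred Gram matrix. It carries the whole
argument: it identifies the centring `pq(q+1)` and the variance of `tr A²`. -/
lemma integral_gramPowerTrace_two_sub_mul {f f' : ℝ → ℝ} (hd : ∀ t, HasDerivAt f (f' t) t)
    (hf : HasAllMoments (fun x => f (gramPowerTrace 2 x)) (gaussianMatrix p q))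
    (hf' : HasAllMoments (fun x => f' (gramPowerTrace 2 x)) (gaussianMatrix p q)) :
    ∫ x, (gramPowerTrace 2 x - p * q * (q + 1)) * f (gramPowerTrace 2 x) ∂gaussianMatrix p q =
      (q + 1) * ∫ x, gramPowerTrace 1 x * f (gramPowerTrace 2 x) ∂gaussianMatrix p q +
      4 * ∫ x, (p * gramPowerTrace 2 x + gramPowerTrace 3 x) * f' (gramPowerTrace 2 x)
        ∂gaussianMatrix p q := by
  have hX := hasAllMoments_dataMatrix (p := p) (q := q)
  have hA := hasAllMoments_centredGram (p := p) (q := q)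
  have h := integral_divergence (p := p) (q := q) (Φ := fun x => dataMatrix x * centredGram x)
    (Φ' := fun k i x => Matrix.single k i (1 : ℝ) * centredGram x + dataMatrix x *
      ((Matrix.single k i (1 : ℝ))ᵀ * dataMatrix x + (dataMatrix x)ᵀ * Matrix.single k i (1 : ℝ)))
    (g := fun x => f (gramPowerTrace 2 x))
    (g' := fun k i x => f' (gramPowerTrace 2 x) * (4 * (dataMatrix x * centredGram x) k i))
    (hX.mul hA)
    (fun k i => ((MatrixHasAllMoments.const _).mul hA).add
      (hX.mul (((MatrixHasAllMoments.const _).mul hX).add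
        (hX.transpose.mul (MatrixHasAllMoments.const _)))))
    hf (fun k i => hf'.mul (((hX.mul hA) k i).const_mul 4))
    (fun x k i => by
      simpa only [Function.update_eq_self] using
        (dataMatrix_hasDerivAt x k i).mul (centredGram_hasDerivAt x k i))
    (fun x k i => by
      have h1 := gramPowerTrace_two_hasDerivAt x k i
      have h2 := (hd (gramPowerTrace 2 (Function.update x (k, i) (x (k, i))))).comp (x (k, i)) h1
      simpa only [Function.update_eq_self] using! h2)
  have hdiv : ∀ x : Fin p × Fin q → ℝ,
      ∑ k : Fin p, ∑ i : Fin q, (Matrix.single k i (1 : ℝ) * centredGram x + dataMatrix x *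
        ((Matrix.single k i (1 : ℝ))ᵀ * dataMatrix x +
          (dataMatrix x)ᵀ * Matrix.single k i (1 : ℝ))) k i =
      p * gramPowerTrace 1 x + (q + 1) * (gramPowerTrace 1 x + p * q) := by
    intro x
    have h1 := sum_mul_single_mul (m := Fin p) (n := Fin q) 1 (centredGram x)
    have h2 := sum_mul_single_transpose_mul (dataMatrix x) (dataMatrix x)
    have h3 := sum_mul_single_mul (m := Fin p) (n := Fin q) (dataMatrix x * (dataMatrix x)ᵀ) 1
    rw [Matrix.trace_mul_comm, trace_gram] at h3
    rw [trace_gram] at h2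
    simp only [Matrix.mul_add, Matrix.add_apply, Finset.sum_add_distrib, ← Matrix.mul_assoc]
    simp only [Matrix.one_mul, Matrix.mul_one, Matrix.trace_one, Fintype.card_fin] at h1 h3
    rw [h1, h2, h3, gramPowerTrace, pow_one]
    ring
  have hgrad : ∀ x : Fin p × Fin q → ℝ, ∑ k, ∑ i, (dataMatrix x * centredGram x) k i *
      (f' (gramPowerTrace 2 x) * (4 * (dataMatrix x * centredGram x) k i)) =
      4 * ((p * gramPowerTrace 2 x + gramPowerTrace 3 x) * f' (gramPowerTrace 2 x)) := by
    intro x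
    have h1 : ∑ k, ∑ i, (dataMatrix x * centredGram x) k i * (dataMatrix x * centredGram x) k i =
        gramPowerTrace 3 x + p * gramPowerTrace 2 x := by
      rw [gramPowerTrace_three_eq, gramPowerTrace_two_eq, Matrix.mul_assoc, ← trace_gram_mul,
        ← Matrix.mul_assoc, Matrix.trace_mul_comm]
      conv_rhs => rw [← Matrix.mul_assoc, ← Matrix.mul_assoc]
      have : centredGram x * (dataMatrix x)ᵀ = (dataMatrix x * centredGram x)ᵀ := by
        rw [Matrix.transpose_mul, isSymm_centredGram]
      rw [this, Matrix.mul_assoc, Finset.sum_comm]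
      simp only [Matrix.trace, Matrix.diag_apply,
        Matrix.mul_apply (M := (dataMatrix x * centredGram x)ᵀ), Matrix.transpose_apply]
    calc _ = 4 * f' (gramPowerTrace 2 x) * ∑ k, ∑ i, (dataMatrix x * centredGram x) k i *
          (dataMatrix x * centredGram x) k i := by
          simp only [Finset.mul_sum]
          exact Finset.sum_congr rfl fun _ _ => Finset.sum_congr rfl fun _ _ => by ring
      _ = _ := by rw [h1]; ring
  have hlhs : ∀ x : Fin p × Fin q → ℝ, ((dataMatrix x)ᵀ * (dataMatrix x * centredGram x)).trace =
      gramPowerTrace 2 x + p * gramPowerTrace 1 x := by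
    intro x
    rw [← Matrix.mul_assoc, trace_gram_mul, gramPowerTrace_two_eq, gramPowerTrace, pow_one]
  simp only [hdiv, hgrad, hlhs] at h
  have hT := hasAllMoments_gramPowerTrace (p := p) (q := q)
  have i1 := ((hT 1).mul hf).integrable
  have i3 := ((((hT 2).const_mul p).add (hT 3)).mul hf').integrable
  have h0 : ∫ x, (gramPowerTrace 2 x - p * q * (q + 1)) * f (gramPowerTrace 2 x)
        ∂gaussianMatrix p q =
      ∫ x, (gramPowerTrace 2 x + p * gramPowerTrace 1 x) * f (gramPowerTrace 2 x)
        ∂gaussianMatrix p q -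
      ∫ x, (p * (gramPowerTrace 1 x * f (gramPowerTrace 2 x)) +
        (p * q * (q + 1) : ℝ) * f (gramPowerTrace 2 x)) ∂gaussianMatrix p q := by
    rw [← integral_sub]
    · congr 1; ext x; ring
    · exact (((hT 2).add ((hT 1).const_mul p)).mul hf).integrable
    · exact (i1.const_mul _).add (hf.integrable.const_mul _)
  rw [h0, h, ← integral_sub, ← integral_const_mul, ← integral_const_mul, ← integral_add]
  · congr 1; ext x; ring
  · exact i1.const_mul _
  · exact i3.const_mul _
  · exact ((((hT 1).const_mul p).add (((hT 1).add (.const _)).const_mul _)).mul hf).integrable.add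
      (i3.const_mul _)
  · exact (i1.const_mul _).add (hf.integrable.const_mul _)

lemma integral_gramPowerTrace_two :
    ∫ x, gramPowerTrace 2 x ∂gaussianMatrix p q = p * q * (q + 1) := by
  have h := integral_gramPowerTrace_two_sub_mul (p := p) (q := q) (f := fun _ => 1)
    (f' := fun _ => 0) (fun t => hasDerivAt_const _ _) (.const 1) (.const 0)
  simp only [mul_one, mul_zero, integral_zero, integral_gramPowerTrace_one, add_zero] at h
  rw [integral_sub (hasAllMoments_gramPowerTrace 2).integrable (integrable_const _)] at h
  simp at h
  linarith

/-- Integration by parts for the field `X A³`. -/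
lemma integral_gramPowerTrace_four :
    ∫ x, gramPowerTrace 4 x ∂gaussianMatrix p q =
      ∫ x, ((3 + q) * (gramPowerTrace 3 x + p * gramPowerTrace 2 x)
        + (gramPowerTrace 1 x + p * q) * gramPowerTrace 2 x
        + (gramPowerTrace 2 x + p * gramPowerTrace 1 x) * gramPowerTrace 1 x)
        ∂gaussianMatrix p q := by
  have hX := hasAllMoments_dataMatrix (p := p) (q := q)
  have hA := hasAllMoments_centredGram (p := p) (q := q)
  have h := integral_divergence (p := p) (q := q)
    (Φ := fun x => dataMatrix x * (centredGram x * centredGram x * centredGram x))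
    (Φ' := fun k i x => Matrix.single k i (1 : ℝ) * (centredGram x * centredGram x * centredGram x)
      + dataMatrix x *
      ((((Matrix.single k i (1 : ℝ))ᵀ * dataMatrix x + (dataMatrix x)ᵀ * Matrix.single k i (1 : ℝ))
        * centredGram x + centredGram x * ((Matrix.single k i (1 : ℝ))ᵀ * dataMatrix x +
          (dataMatrix x)ᵀ * Matrix.single k i (1 : ℝ))) * centredGram x +
      centredGram x * centredGram x *
        ((Matrix.single k i (1 : ℝ))ᵀ * dataMatrix x +
          (dataMatrix x)ᵀ * Matrix.single k i (1 : ℝ))))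
    (g := fun _ => 1) (g' := fun _ _ _ => 0)
    (hX.mul ((hA.mul hA).mul hA))
    (fun k i => by
      have hD := ((MatrixHasAllMoments.const (μ := gaussianMatrix p q)
        (Matrix.single k i (1 : ℝ))ᵀ).mul hX).add
        (hX.transpose.mul (MatrixHasAllMoments.const (Matrix.single k i (1 : ℝ))))
      exact ((MatrixHasAllMoments.const _).mul ((hA.mul hA).mul hA)).add
        (hX.mul ((((hD.mul hA).add (hA.mul hD)).mul hA).add ((hA.mul hA).mul hD))))
    (.const 1) (fun k i => .const 0)
    (fun x k i => by
      have h1 := centredGram_hasDerivAt x k i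
      simpa only [Function.update_eq_self] using
        (dataMatrix_hasDerivAt x k i).mul ((h1.mul h1).mul h1))
    (fun x k i => hasDerivAt_const _ _)
  have hdiv : ∀ x : Fin p × Fin q → ℝ,
      ∑ k : Fin p, ∑ i : Fin q, (Matrix.single k i (1 : ℝ) *
        (centredGram x * centredGram x * centredGram x)
      + dataMatrix x *
      ((((Matrix.single k i (1 : ℝ))ᵀ * dataMatrix x + (dataMatrix x)ᵀ * Matrix.single k i (1 : ℝ))
        * centredGram x + centredGram x * ((Matrix.single k i (1 : ℝ))ᵀ * dataMatrix x +
          (dataMatrix x)ᵀ * Matrix.single k i (1 : ℝ))) * centredGram x +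
      centredGram x * centredGram x *
        ((Matrix.single k i (1 : ℝ))ᵀ * dataMatrix x +
          (dataMatrix x)ᵀ * Matrix.single k i (1 : ℝ)))) k i =
      p * gramPowerTrace 3 x + ((3 + q) * (gramPowerTrace 3 x + p * gramPowerTrace 2 x)
        + (gramPowerTrace 1 x + p * q) * gramPowerTrace 2 x
        + (gramPowerTrace 2 x + p * gramPowerTrace 1 x) * gramPowerTrace 1 x) := by
    intro x
    -- after expansion, each summand is `Y B Eᵀ C` or `B E C` with `E` the matrix unit at `(k, i)`
    set Y := dataMatrix x
    set A := centredGram x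
    have hAt : Aᵀ = A := isSymm_centredGram x
    have hYY : ∀ B, (Yᵀ * Y * B).trace = (A * B).trace + (p : ℝ) * B.trace := trace_gram_mul x
    have t1 : gramPowerTrace 1 x = A.trace := by rw [gramPowerTrace, pow_one]
    have t2 : gramPowerTrace 2 x = (A * A).trace := gramPowerTrace_two_eq x
    have t3 : gramPowerTrace 3 x = (A * A * A).trace := gramPowerTrace_three_eq x
    have s0 := sum_mul_single_mul (m := Fin p) (n := Fin q) 1 (A * A * A)
    have s1 := sum_mul_single_transpose_mul Y (Y * A * A)
    have s2 := sum_mul_single_mul (Y * Yᵀ) (A * A)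
    have s3 := sum_mul_single_transpose_mul (Y * A) (Y * A)
    have s4 := sum_mul_single_mul (Y * A * Yᵀ) A
    have s5 := sum_mul_single_transpose_mul (Y * A * A) Y
    have s6 := sum_mul_single_mul (m := Fin p) (n := Fin q) (Y * A * A * Yᵀ) 1
    have e1 : (Yᵀ * (Y * A * A)).trace = gramPowerTrace 3 x + p * gramPowerTrace 2 x := by
      rw [Matrix.mul_assoc Y, ← Matrix.mul_assoc, hYY, t3, t2, Matrix.mul_assoc]
    have e2 : (Y * Yᵀ).trace = gramPowerTrace 1 x + p * q := by
      rw [Matrix.trace_mul_comm, ← trace_gram]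
    have e3 : ((Y * A)ᵀ * (Y * A)).trace = gramPowerTrace 3 x + p * gramPowerTrace 2 x := by
      rw [← e1, Matrix.transpose_mul, hAt, Matrix.mul_assoc, Matrix.trace_mul_comm,
        Matrix.mul_assoc]
    have e4 : (Y * A * Yᵀ).trace = gramPowerTrace 2 x + p * gramPowerTrace 1 x := by
      rw [Matrix.trace_mul_comm, ← Matrix.mul_assoc, hYY, t1, t2]
    have e5 : ((Y * A * A)ᵀ * Y).trace = gramPowerTrace 3 x + p * gramPowerTrace 2 x := by
      rw [← e1, ← Matrix.trace_transpose]
      simp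
    have e6 : (Y * A * A * Yᵀ).trace = gramPowerTrace 3 x + p * gramPowerTrace 2 x := by
      rw [← e1, Matrix.trace_mul_comm]
    rw [e1] at s1
    rw [e2] at s2
    rw [e3] at s3
    rw [e4] at s4
    rw [e5] at s5
    rw [e6] at s6
    simp only [Matrix.one_mul, Matrix.mul_one, Matrix.trace_one, Fintype.card_fin] at s0 s6
    simp only [← Matrix.mul_assoc] at s0 s1 s2 s3 s4 s5 s6
    simp only [Matrix.mul_add, Matrix.add_mul, Matrix.add_apply, Finset.sum_add_distrib,
      ← Matrix.mul_assoc]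
    rw [s0, s1, s2, s3, s4, s5, s6, ← t1, ← t2, ← t3]
    ring
  have hlhs : ∀ x : Fin p × Fin q → ℝ, ((dataMatrix x)ᵀ *
      (dataMatrix x * (centredGram x * centredGram x * centredGram x))).trace =
      gramPowerTrace 4 x + p * gramPowerTrace 3 x := by
    intro x
    rw [← Matrix.mul_assoc, trace_gram_mul, gramPowerTrace_four_eq, gramPowerTrace_three_eq]
    simp only [Matrix.mul_assoc]
  simp only [hdiv, hlhs, mul_one, mul_zero, Finset.sum_const_zero, add_zero] at h
  have hT := hasAllMoments_gramPowerTrace (p := p) (q := q)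
  rw [integral_add (hT 4).integrable ((hT 3).integrable.const_mul _), integral_add
    ((hT 3).integrable.const_mul _)] at h
  · linarith
  · exact (((((hT 3).add ((hT 2).const_mul _)).const_mul _).add
      (((hT 1).add (.const _)).mul (hT 2))).add
      (((hT 2).add ((hT 1).const_mul _)).mul (hT 1))).integrable

end GramMoments

/-! ### Spectral expressions -/

section Spectral

variable {m : Type*} [Fintype m] [DecidableEq m] {M : Matrix m m ℝ}

lemma Matrix.IsHermitian.trace_sub_smul_one_pow (hM : M.IsHermitian) (c : ℝ) (r : ℕ) :
    ((M - c • 1) ^ r).trace = ∑ i, (hM.eigenvalues i - c) ^ r := by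
  have h : (M - c • 1) ^ r = Unitary.conjStarAlgAut ℝ _ hM.eigenvectorUnitary
      (diagonal fun i => (hM.eigenvalues i - c) ^ r) := by
    have hd : diagonal (fun i => (hM.eigenvalues i - c) ^ r) =
        (diagonal (RCLike.ofReal ∘ hM.eigenvalues) - c • (1 : Matrix m m ℝ)) ^ r := by
      rw [← Matrix.diagonal_one, ← Matrix.diagonal_smul, Matrix.diagonal_sub, Matrix.diagonal_pow]
      congr 1; ext i; simp
    rw [hd, map_pow, map_sub, map_smul, map_one, ← hM.spectral_theorem]
  rw [h, Unitary.conjStarAlgAut_apply, Matrix.trace_mul_comm, ← Matrix.mul_assoc]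
  simp [Matrix.trace]

lemma Matrix.IsHermitian.det_one_sub_smul (hM : M.IsHermitian) (a : ℝ) :
    (1 - a • M).det = ∏ i, (1 - a * hM.eigenvalues i) := by
  have h : 1 - a • M = Unitary.conjStarAlgAut ℝ _ hM.eigenvectorUnitary
      (diagonal fun i => 1 - a * hM.eigenvalues i) := by
    have hd : diagonal (fun i => 1 - a * hM.eigenvalues i) =
        (1 - a • diagonal (RCLike.ofReal ∘ hM.eigenvalues) : Matrix m m ℝ) := by
      rw [← Matrix.diagonal_one, ← Matrix.diagonal_smul, Matrix.diagonal_sub]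
      congr 1
    rw [hd, map_sub, map_smul, map_one, ← hM.spectral_theorem]
  rw [h, Unitary.conjStarAlgAut_apply, Matrix.det_mul_comm, ← Matrix.mul_assoc]
  simp

variable {p q : ℕ}

lemma gramPowerTrace_eq_sum (r : ℕ) (x : Fin p × Fin q → ℝ) :
    gramPowerTrace r x = ∑ i, (gramEigenvalues (dataMatrix x) i - p) ^ r :=
  Matrix.IsHermitian.trace_sub_smul_one_pow _ _ _

lemma gramPowerTrace_two_nonneg (x : Fin p × Fin q → ℝ) : 0 ≤ gramPowerTrace 2 x := by
  rw [gramPowerTrace_eq_sum]; positivity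

lemma gramPowerTrace_four_nonneg (x : Fin p × Fin q → ℝ) : 0 ≤ gramPowerTrace 4 x := by
  rw [gramPowerTrace_eq_sum]
  exact Finset.sum_nonneg fun i _ => Even.pow_nonneg (by decide) _

/-- Termwise `2 |y|³ ≤ s y² + y⁴ / s`; the choice `s = √(pq)` balances the two sides. -/
lemma sum_abs_pow_three_le {s : ℝ} (hs : 0 < s) (x : Fin p × Fin q → ℝ) :
    ∑ i, |gramEigenvalues (dataMatrix x) i - p| ^ 3 ≤
      (s * gramPowerTrace 2 x + gramPowerTrace 4 x / s) / 2 := by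
  rw [gramPowerTrace_eq_sum, gramPowerTrace_eq_sum, Finset.mul_sum, Finset.sum_div,
    ← Finset.sum_add_distrib, Finset.sum_div]
  refine Finset.sum_le_sum fun i _ => ?_
  set y := gramEigenvalues (dataMatrix x) i - p
  have h : 0 ≤ y ^ 2 * (s - |y|) ^ 2 / s := by positivity
  have e : y ^ 2 * (s - |y|) ^ 2 / s = s * y ^ 2 + y ^ 4 / s - 2 * |y| ^ 3 := by
    rw [← sq_abs y, show y ^ 4 = |y| ^ 4 by rw [← abs_pow, abs_of_nonneg (by positivity)]]
    field_simp; ring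
  linarith

lemma abs_gramPowerTrace_three_le {s : ℝ} (hs : 0 < s) (x : Fin p × Fin q → ℝ) :
    |gramPowerTrace 3 x| ≤ (s * gramPowerTrace 2 x + gramPowerTrace 4 x / s) / 2 := by
  refine le_trans ?_ (sum_abs_pow_three_le hs x)
  rw [gramPowerTrace_eq_sum]
  refine (Finset.abs_sum_le_sum_abs _ _).trans (Finset.sum_le_sum fun i _ => ?_)
  rw [abs_pow]

lemma gramPowerTrace_two_sq_le (x : Fin p × Fin q → ℝ) :
    gramPowerTrace 2 x ^ 2 ≤ q * gramPowerTrace 4 x := by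
  rw [gramPowerTrace_eq_sum, gramPowerTrace_eq_sum]
  have := sq_sum_le_card_mul_sum_sq (s := Finset.univ)
    (f := fun i => (gramEigenvalues (dataMatrix x) i - (p : ℝ)) ^ 2)
  simpa [← pow_mul] using this

end Spectral

/-! ### Moment bounds for the centred Gram matrix -/

section Bounds

variable {p q : ℕ}

/-- The right-hand side of `integral_gramPowerTrace_four` is at most `T_4 / 2` plus lower-order
terms, where `T_r = tr A ^ r`, so the fourth moment can be absorbed. -/
lemma integral_gramPowerTrace_four_le (hq : 1 ≤ q) (hqp : q ≤ p) :
    ∫ x, gramPowerTrace 4 x ∂gaussianMatrix p q ≤ 104 * (p : ℝ) ^ 2 * (q : ℝ) ^ 3 := by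
  have hT := hasAllMoments_gramPowerTrace (p := p) (q := q)
  have hq' : (1 : ℝ) ≤ q := by exact_mod_cast hq
  have hqp' : (q : ℝ) ≤ p := by exact_mod_cast hqp
  have hpt : ∀ x : Fin p × Fin q → ℝ, (3 + q) * (gramPowerTrace 3 x + p * gramPowerTrace 2 x)
        + (gramPowerTrace 1 x + p * q) * gramPowerTrace 2 x
        + (gramPowerTrace 2 x + p * gramPowerTrace 1 x) * gramPowerTrace 1 x ≤
      1 / 2 * gramPowerTrace 4 x + ((3 + q) ^ 2 + (2 * p * q + 3 * p)) * gramPowerTrace 2 x +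
        (4 * q + p) * gramPowerTrace 1 x ^ 2 := by
    intro x
    -- the weight `2 (3 + q)` leaves exactly `T_4 / 4`
    have h3 := (le_abs_self _).trans
      (abs_gramPowerTrace_three_le (s := 2 * (3 + q)) (by positivity) x)
    have h3' : (3 + q) * gramPowerTrace 3 x ≤
        (3 + q) ^ 2 * gramPowerTrace 2 x + gramPowerTrace 4 x / 4 := by
      calc (3 + q) * gramPowerTrace 3 x ≤ (3 + q) *
            ((2 * (3 + q) * gramPowerTrace 2 x + gramPowerTrace 4 x / (2 * (3 + q))) / 2) := by
            gcongr
        _ = _ := by field_simp; ring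
    have h2 := gramPowerTrace_two_sq_le x
    have h12 : 2 * (gramPowerTrace 1 x * gramPowerTrace 2 x) ≤
        4 * q * gramPowerTrace 1 x ^ 2 + gramPowerTrace 4 x / 4 := by
      have : 0 ≤ (4 * q * gramPowerTrace 1 x - gramPowerTrace 2 x) ^ 2 := sq_nonneg _
      have hle : q * (2 * (gramPowerTrace 1 x * gramPowerTrace 2 x)) ≤
        q * (4 * q * gramPowerTrace 1 x ^ 2 + gramPowerTrace 4 x / 4) := by nlinarith
      exact le_of_mul_le_mul_left hle (by linarith)
    linarith
  have h := integral_gramPowerTrace_four (p := p) (q := q)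
  have hmono := integral_mono
    ((((((hT 3).add ((hT 2).const_mul p)).const_mul (3 + q)).add
      (((hT 1).add (.const (p * q : ℝ))).mul (hT 2))).add
      (((hT 2).add ((hT 1).const_mul p)).mul (hT 1))).integrable)
    ((((hT 4).const_mul (1 / 2)).add
      ((hT 2).const_mul ((3 + q) ^ 2 + (2 * p * q + 3 * p)))).add
      (((hT 1).pow 2).const_mul (4 * q + p))).integrable hpt
  rw [← h, integral_add (((hT 4).const_mul _).add ((hT 2).const_mul _)).integrable
      (((hT 1).pow 2).const_mul _).integrable,
    integral_add ((hT 4).const_mul _).integrable ((hT 2).const_mul _).integrable,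
    integral_const_mul, integral_const_mul, integral_const_mul, integral_gramPowerTrace_two,
    integral_gramPowerTrace_one_sq] at hmono
  have hp : (1 : ℝ) ≤ p := hq'.trans hqp'
  have b1 : ((3 + q) ^ 2 + (2 * p * q + 3 * p) : ℝ) ≤ 21 * (p * q) := by nlinarith
  have b2 : (p * q * (q + 1) : ℝ) ≤ 2 * (p * q ^ 2) := by
    nlinarith [mul_nonneg (by linarith : (0 : ℝ) ≤ p) (by nlinarith : (0 : ℝ) ≤ q * q - q)]
  have b3 : ((3 + q) ^ 2 + (2 * p * q + 3 * p) : ℝ) * (p * q * (q + 1)) ≤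
      21 * (p * q) * (2 * (p * q ^ 2)) := by gcongr
  have b4 : (4 * q + p : ℝ) * (2 * p * q) ≤ 5 * p * (2 * p * q) := by gcongr; linarith
  have b5 : (p ^ 2 * q : ℝ) ≤ p ^ 2 * q ^ 3 := by
    gcongr; exact le_self_pow₀ hq' (by norm_num)
  nlinarith

/-- The first moment of the combination that dominates `∑ |λᵢ - p|³`. -/
lemma integral_cubic_bound_le (hq : 1 ≤ q) (hqp : q ≤ p) {s : ℝ} (hs : 0 < s)
    (hs2 : s ^ 2 = p * q) :
    ∫ x, (s * gramPowerTrace 2 x + gramPowerTrace 4 x / s) / 2 ∂gaussianMatrix p q ≤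
      53 * s ^ 3 * q := by
  have hT := hasAllMoments_gramPowerTrace (p := p) (q := q)
  have hq' : (1 : ℝ) ≤ q := by exact_mod_cast hq
  have e : ∀ x : Fin p × Fin q → ℝ, (s * gramPowerTrace 2 x + gramPowerTrace 4 x / s) / 2 =
      s / 2 * gramPowerTrace 2 x + 1 / (2 * s) * gramPowerTrace 4 x := fun x => by
    field_simp
  simp only [e]
  rw [integral_add ((hT 2).const_mul _).integrable ((hT 4).const_mul _).integrable,
    integral_const_mul, integral_const_mul, integral_gramPowerTrace_two, ← hs2]
  have h4 := integral_gramPowerTrace_four_le hq hqp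
  have h4' : 1 / (2 * s) * ∫ x, gramPowerTrace 4 x ∂gaussianMatrix p q ≤ 52 * s ^ 3 * q := by
    calc 1 / (2 * s) * ∫ x, gramPowerTrace 4 x ∂gaussianMatrix p q
        ≤ 1 / (2 * s) * (104 * (p : ℝ) ^ 2 * (q : ℝ) ^ 3) := by gcongr
      _ = 1 / (2 * s) * (104 * (p * q : ℝ) ^ 2 * q) := by ring
      _ = _ := by rw [← hs2]; field_simp; ring
  have h2 : s / 2 * (s ^ 2 * (q + 1)) ≤ s ^ 3 * q := by
    calc s / 2 * (s ^ 2 * (q + 1)) = s ^ 3 * ((q + 1) / 2) := by ring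
      _ ≤ s ^ 3 * q := by gcongr; linarith
  linarith

lemma integral_abs_gramPowerTrace_three_le (hq : 1 ≤ q) (hqp : q ≤ p) {s : ℝ} (hs : 0 < s)
    (hs2 : s ^ 2 = p * q) :
    ∫ x, |gramPowerTrace 3 x| ∂gaussianMatrix p q ≤ 53 * s ^ 3 * q := by
  have hT := hasAllMoments_gramPowerTrace (p := p) (q := q)
  refine le_trans (integral_mono (hT 3).abs.integrable ?_
    fun x => abs_gramPowerTrace_three_le hs x) (integral_cubic_bound_le hq hqp hs hs2)
  exact (((hT 2).const_mul s).integrable.add ((hT 4).integrable.div_const s)).div_const 2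

/-- An `L¹` bound from an `L²` bound, by `2 |F| ≤ s + F² / s`. -/
lemma integral_abs_le_of_integral_sq_le {Ω : Type*} [MeasurableSpace Ω] {μ : Measure Ω}
    [IsProbabilityMeasure μ] {F : Ω → ℝ} (hF : HasAllMoments F μ) {s C : ℝ} (hs : 0 < s)
    (h : ∫ x, F x ^ 2 ∂μ ≤ C * s ^ 2) : ∫ x, |F x| ∂μ ≤ (1 + C) / 2 * s := by
  have hpt : ∀ x, |F x| ≤ s / 2 + 1 / (2 * s) * F x ^ 2 := by
    intro x
    have : 0 ≤ (|F x| - s) ^ 2 / (2 * s) := by positivity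
    have e : (|F x| - s) ^ 2 / (2 * s) = s / 2 + 1 / (2 * s) * F x ^ 2 - |F x| := by
      rw [← sq_abs (F x)]; field_simp; ring
    linarith
  have := integral_mono hF.abs.integrable
    ((integrable_const _).add ((hF.pow 2).const_mul _).integrable) hpt
  refine this.trans ?_
  simp only [Pi.add_apply]
  rw [integral_add (integrable_const _) ((hF.pow 2).const_mul _).integrable, integral_const_mul]
  simp only [integral_const, probReal_univ, smul_eq_mul, one_mul]
  calc s / 2 + 1 / (2 * s) * ∫ x, F x ^ 2 ∂μ ≤ s / 2 + 1 / (2 * s) * (C * s ^ 2) := by gcongr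
    _ = _ := by field_simp

lemma integral_abs_gramPowerTrace_one_le {s : ℝ} (hs : 0 < s) (hs2 : s ^ 2 = p * q) :
    ∫ x, |gramPowerTrace 1 x| ∂gaussianMatrix p q ≤ 3 / 2 * s := by
  have := integral_abs_le_of_integral_sq_le (hasAllMoments_gramPowerTrace (p := p) (q := q) 1)
    (C := 2) hs (by rw [integral_gramPowerTrace_one_sq, hs2, mul_assoc])
  linarith

/-- The variance of `tr A²` is of order `p²q²`. -/
lemma integral_gramPowerTrace_two_sub_sq_le (hq : 1 ≤ q) (hqp : q ≤ p) :
    ∫ x, (gramPowerTrace 2 x - p * q * (q + 1)) ^ 2 ∂gaussianMatrix p q ≤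
      448 * (p * q : ℝ) ^ 2 := by
  have hT := hasAllMoments_gramPowerTrace (p := p) (q := q)
  have hq' : (1 : ℝ) ≤ q := by exact_mod_cast hq
  have hqp' : (q : ℝ) ≤ p := by exact_mod_cast hqp
  have hp' : (1 : ℝ) ≤ p := hq'.trans hqp'
  set c : ℝ := p * q * (q + 1) with hc
  have hV : HasAllMoments (fun x => gramPowerTrace 2 x - c) (gaussianMatrix p q) :=
    (hT 2).sub (.const c)
  have h := integral_gramPowerTrace_two_sub_mul (p := p) (q := q) (f := fun t => t - c)
    (f' := fun _ => 1) (fun t => (hasDerivAt_id t).sub_const c) hV (.const 1)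
  simp only [← hc, mul_one] at h
  obtain ⟨s, hs, hs2⟩ : ∃ s : ℝ, 0 < s ∧ s ^ 2 = p * q :=
    ⟨√(p * q), by positivity, Real.sq_sqrt (by positivity)⟩
  -- half of the variance is absorbed on the left-hand side
  have hcross : (q + 1) * ∫ x, gramPowerTrace 1 x * (gramPowerTrace 2 x - c) ∂gaussianMatrix p q ≤
      1 / 2 * ∫ x, (gramPowerTrace 2 x - c) ^ 2 ∂gaussianMatrix p q + (q + 1) ^ 2 * (p * q) := by
    have hm : ∫ x, (q + 1) * (gramPowerTrace 1 x * (gramPowerTrace 2 x - c)) ∂gaussianMatrix p q ≤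
        ∫ x, (1 / 2 * (gramPowerTrace 2 x - c) ^ 2 + (q + 1) ^ 2 / 2 * gramPowerTrace 1 x ^ 2)
          ∂gaussianMatrix p q := by
      refine integral_mono (((hT 1).mul hV).const_mul _).integrable
        (((hV.pow 2).const_mul _).add (((hT 1).pow 2).const_mul _)).integrable fun x => ?_
      have := sq_nonneg ((q + 1) * gramPowerTrace 1 x - (gramPowerTrace 2 x - c))
      simp only
      nlinarith
    rw [integral_const_mul, integral_add ((hV.pow 2).const_mul _).integrable
      (((hT 1).pow 2).const_mul _).integrable, integral_const_mul, integral_const_mul,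
      integral_gramPowerTrace_one_sq] at hm
    linarith
  have h3 : ∫ x, (p * gramPowerTrace 2 x + gramPowerTrace 3 x) ∂gaussianMatrix p q ≤
      p * c + 53 * s ^ 3 * q := by
    rw [integral_add ((hT 2).const_mul _).integrable (hT 3).integrable, integral_const_mul,
      integral_gramPowerTrace_two]
    have := (integral_mono (hT 3).integrable (hT 3).abs.integrable fun x => le_abs_self _).trans
      (integral_abs_gramPowerTrace_three_le hq hqp hs hs2)
    linarith
  have hsp : s ≤ p := by nlinarith
  have b0 : s ^ 3 * q ≤ (p * q : ℝ) ^ 2 := by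
    calc s ^ 3 * q = s * (p * q) * q := by rw [← hs2]; ring
      _ ≤ p * (p * q) * q := by gcongr
      _ = _ := by ring
  have b1 : ((q + 1) ^ 2 * (p * q) : ℝ) ≤ 4 * (p * q) ^ 2 := by
    calc ((q + 1) ^ 2 * (p * q) : ℝ) ≤ (2 * q) ^ 2 * (p * q) := by gcongr; linarith
      _ = 4 * (q * q) * (p * q) := by ring
      _ ≤ 4 * (p * q) * (p * q) := by gcongr
      _ = _ := by ring
  have b2 : p * c ≤ 2 * (p * q : ℝ) ^ 2 := by
    calc p * c = p * p * q * (q + 1) := by rw [hc]; ring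
      _ ≤ p * p * q * (2 * q) := by gcongr; linarith
      _ = _ := by ring
  have e : ∀ x : Fin p × Fin q → ℝ, (gramPowerTrace 2 x - c) ^ 2 =
    (gramPowerTrace 2 x - c) * (gramPowerTrace 2 x - c) := fun x => sq _
  simp only [e] at hcross ⊢
  linarith

/-- A quantitative form of the Gaussian characterisation `E[V f(V)] = v E[f'(V)]` for
`V = tr A² - pq(q+1)`. -/
lemma abs_integral_stein_le (hq : 1 ≤ q) (hqp : q ≤ p) {s : ℝ} (hs : 0 < s)
    (hs2 : s ^ 2 = p * q) {f f' : ℝ → ℝ} (hd : ∀ t, HasDerivAt f (f' t) t)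
    (hf' : Measurable f') {K : ℝ} (hb : ∀ t, |f t| ≤ 1) (hb' : ∀ t, |f' t| ≤ K) :
    |∫ x, (gramPowerTrace 2 x - p * q * (q + 1)) * f (gramPowerTrace 2 x) ∂gaussianMatrix p q -
      4 * p * (p * q * (q + 1)) * ∫ x, f' (gramPowerTrace 2 x) ∂gaussianMatrix p q| ≤
    3 / 2 * (q + 1) * s + 4 * (225 * p * s ^ 2 + 53 * s ^ 3 * q) * K := by
  have hT := hasAllMoments_gramPowerTrace (p := p) (q := q)
  set c : ℝ := p * q * (q + 1) with hc
  have hfc : Continuous f := continuous_iff_continuousAt.2 fun t => (hd t).continuousAt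
  have hT2 := (hT 2).integrable.aestronglyMeasurable.aemeasurable
  have mf : HasAllMoments (fun x => f (gramPowerTrace 2 x)) (gaussianMatrix p q) :=
    .of_bounded (hfc.measurable.comp_aemeasurable hT2).aestronglyMeasurable 1 fun x => hb _
  have mf' : HasAllMoments (fun x => f' (gramPowerTrace 2 x)) (gaussianMatrix p q) :=
    .of_bounded (hf'.comp_aemeasurable hT2).aestronglyMeasurable K fun x => hb' _
  have hV : HasAllMoments (fun x => gramPowerTrace 2 x - c) (gaussianMatrix p q) :=
    (hT 2).sub (.const c)
  have h := integral_gramPowerTrace_two_sub_mul (p := p) (q := q) hd mf mf'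
  -- `p tr A²` is replaced by its mean `p c`
  have hsplit : ∫ x, (p * gramPowerTrace 2 x + gramPowerTrace 3 x) * f' (gramPowerTrace 2 x)
        ∂gaussianMatrix p q = p * c * ∫ x, f' (gramPowerTrace 2 x) ∂gaussianMatrix p q +
      ∫ x, (p * (gramPowerTrace 2 x - c) + gramPowerTrace 3 x) * f' (gramPowerTrace 2 x)
        ∂gaussianMatrix p q := by
    rw [← integral_const_mul, ← integral_add (mf'.const_mul _).integrable
      (((hV.const_mul _).add (hT 3)).mul mf').integrable]
    congr 1; ext x; ring
  rw [← hc, hsplit] at h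
  rw [h]
  have k1 : |∫ x, gramPowerTrace 1 x * f (gramPowerTrace 2 x) ∂gaussianMatrix p q| ≤ 3 / 2 * s := by
    refine (abs_integral_le_integral_abs).trans (le_trans (integral_mono
      ((hT 1).mul mf).abs.integrable (hT 1).abs.integrable fun x => ?_)
      (integral_abs_gramPowerTrace_one_le hs hs2))
    simp only [abs_mul]
    exact mul_le_of_le_one_right (abs_nonneg _) (hb _)
  have kV : ∫ x, |gramPowerTrace 2 x - c| ∂gaussianMatrix p q ≤ 225 * s ^ 2 := by
    have := integral_abs_le_of_integral_sq_le hV (s := s ^ 2) (C := 448) (by positivity)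
      (by rw [hs2]; exact integral_gramPowerTrace_two_sub_sq_le hq hqp)
    have : 0 ≤ s ^ 2 := by positivity
    linarith
  have k2 : |∫ x, (p * (gramPowerTrace 2 x - c) + gramPowerTrace 3 x) * f' (gramPowerTrace 2 x)
      ∂gaussianMatrix p q| ≤ (225 * p * s ^ 2 + 53 * s ^ 3 * q) * K := by
    have hK : 0 ≤ K := (abs_nonneg _).trans (hb' 0)
    calc _ ≤ ∫ x, |(p * (gramPowerTrace 2 x - c) + gramPowerTrace 3 x) * f' (gramPowerTrace 2 x)|
          ∂gaussianMatrix p q := abs_integral_le_integral_abs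
      _ ≤ ∫ x, (p * |gramPowerTrace 2 x - c| + |gramPowerTrace 3 x|) * K ∂gaussianMatrix p q := by
          refine integral_mono (((hV.const_mul _).add (hT 3)).mul mf').abs.integrable
            (((hV.abs.const_mul _).add (hT 3).abs).mul (.const K)).integrable fun x => ?_
          simp only [abs_mul]
          gcongr
          · refine (abs_add_le _ _).trans ?_
            rw [abs_mul, Nat.abs_cast]
          · exact hb' _
      _ = (p * ∫ x, |gramPowerTrace 2 x - c| ∂gaussianMatrix p q +
          ∫ x, |gramPowerTrace 3 x| ∂gaussianMatrix p q) * K := by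
          rw [integral_mul_const, integral_add (hV.abs.const_mul _).integrable
            (hT 3).abs.integrable, integral_const_mul]
      _ ≤ (p * (225 * s ^ 2) + 53 * s ^ 3 * q) * K := by
          gcongr
          exact integral_abs_gramPowerTrace_three_le hq hqp hs hs2
      _ = _ := by ring
  rw [abs_le] at k1 k2 ⊢
  have hq0 : (0 : ℝ) ≤ q + 1 := by positivity
  constructor <;> nlinarith

end Bounds

/-! ### Characteristic functions from approximate Stein identities -/

section CharFun

variable {Ω : Type*} [MeasurableSpace Ω] {μ : Measure Ω} [IsProbabilityMeasure μ] {V : Ω → ℝ}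

/-- Differentiation of `t ↦ E[f (t V)]` under the expectation. -/
lemma hasDerivAt_integral_comp_mul {f f' : ℝ → ℝ} (hd : ∀ t, HasDerivAt f (f' t) t)
    (hf' : Continuous f') (hb : ∀ t, |f t| ≤ 1) (hb' : ∀ t, |f' t| ≤ 1) (hV : Integrable V μ)
    (t : ℝ) :
    HasDerivAt (fun t => ∫ ω, f (t * V ω) ∂μ) (∫ ω, V ω * f' (t * V ω) ∂μ) t := by
  have hfc : Continuous f := continuous_iff_continuousAt.2 fun t => (hd t).continuousAt
  have hVm := hV.aestronglyMeasurable
  refine (hasDerivAt_integral_of_dominated_loc_of_deriv_le (μ := μ) (bound := fun ω => |V ω|)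
    (F := fun t ω => f (t * V ω)) (F' := fun t ω => V ω * f' (t * V ω)) (x₀ := t)
    (Metric.ball_mem_nhds t one_pos) ?_ ?_ ?_ ?_ hV.abs ?_).2
  · exact Eventually.of_forall fun s => hfc.comp_aestronglyMeasurable (hVm.const_mul s)
  · exact Integrable.of_bound (hfc.comp_aestronglyMeasurable (hVm.const_mul t)) 1
      (ae_of_all _ fun ω => hb _)
  · exact hVm.mul (hf'.comp_aestronglyMeasurable (hVm.const_mul t))
  · refine ae_of_all _ fun ω s _ => ?_
    rw [Real.norm_eq_abs, abs_mul]
    exact mul_le_of_le_one_right (abs_nonneg _) (hb' _)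
  · refine ae_of_all _ fun ω s _ => ?_
    have := (hd (s * V ω)).comp s ((hasDerivAt_id s).mul_const (V ω))
    simpa [mul_comm, Function.comp_def] using this

/-- A function that almost solves `φ' = -v t φ` is close to `φ(0) exp (-v t² / 2)`. -/
lemma abs_sub_exp_le_of_deriv_bound {φ φ' : ℝ → ℝ} (hd : ∀ t, HasDerivAt φ (φ' t) t) {v ε ε' : ℝ}
    (hv : 0 ≤ v) (hε' : 0 ≤ ε') (h : ∀ t, |φ' t + v * t * φ t| ≤ ε + |t| * ε')
    (t : ℝ) : |φ t - φ 0 * Real.exp (-(v * t ^ 2 / 2))| ≤ |t| * (ε + |t| * ε') := by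
  -- the integrating factor `exp (v s² / 2)`
  set G : ℝ → ℝ := fun s => φ s * Real.exp (v * s ^ 2 / 2) with hG
  have hGd : ∀ s, HasDerivAt G ((φ' s + v * s * φ s) * Real.exp (v * s ^ 2 / 2)) s := by
    intro s
    have h1 : HasDerivAt (fun s : ℝ => v * s ^ 2 / 2) (v * s) s := by
      have := (((hasDerivAt_id s).pow 2).const_mul v).div_const 2
      convert! this using 1
      simp; ring
    have := (hd s).mul h1.exp
    convert! this using 1
    ring
  have hbound : ∀ s ∈ Set.uIcc 0 t, ‖(φ' s + v * s * φ s) * Real.exp (v * s ^ 2 / 2)‖ ≤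
      (ε + |t| * ε') * Real.exp (v * t ^ 2 / 2) := by
    intro s hs
    have hst : |s| ≤ |t| := by
      have := Set.abs_sub_left_of_mem_uIcc hs
      simpa using this
    have hsq : s ^ 2 ≤ t ^ 2 := sq_le_sq.2 hst
    rw [norm_mul, Real.norm_eq_abs, Real.norm_eq_abs, Real.abs_exp]
    have h0 : 0 ≤ ε + |t| * ε' :=
      (abs_nonneg _).trans (h t)
    gcongr
    exact (h s).trans (by gcongr)
  have hmv := Convex.norm_image_sub_le_of_norm_hasDerivWithin_le
    (fun s _ => (hGd s).hasDerivWithinAt) hbound (convex_uIcc 0 t)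
    Set.left_mem_uIcc Set.right_mem_uIcc
  have e : φ t - φ 0 * Real.exp (-(v * t ^ 2 / 2)) =
      (G t - G 0) * Real.exp (-(v * t ^ 2 / 2)) := by
    simp only [hG]
    rw [sub_mul, mul_assoc, ← Real.exp_add]
    simp
  rw [e, abs_mul, Real.abs_exp]
  calc |G t - G 0| * Real.exp (-(v * t ^ 2 / 2))
      ≤ ((ε + |t| * ε') * Real.exp (v * t ^ 2 / 2) * |t|) * Real.exp (-(v * t ^ 2 / 2)) := by
        gcongr
        simpa using hmv
    _ = |t| * (ε + |t| * ε') * (Real.exp (v * t ^ 2 / 2) * Real.exp (-(v * t ^ 2 / 2))) := by ring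
    _ = _ := by rw [← Real.exp_add]; simp

/-- If `V` satisfies the Gaussian Stein identity up to a small error for all `sin (t ·)` and
`cos (t ·)`, then its characteristic function is close to that of `N(0, v)`. -/
lemma norm_integral_cexp_sub_le {v ε ε' : ℝ} (hV : Integrable V μ) (hv : 0 ≤ v) (hε' : 0 ≤ ε')
    (hsin : ∀ t, |∫ ω, V ω * Real.sin (t * V ω) ∂μ - v * t * ∫ ω, Real.cos (t * V ω) ∂μ| ≤
      ε + |t| * ε')
    (hcos : ∀ t, |∫ ω, V ω * Real.cos (t * V ω) ∂μ + v * t * ∫ ω, Real.sin (t * V ω) ∂μ| ≤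
      ε + |t| * ε') (t : ℝ) :
    ‖∫ ω, Complex.exp (t * V ω * Complex.I) ∂μ - (Real.exp (-(v * t ^ 2 / 2)) : ℂ)‖ ≤
      2 * (|t| * (ε + |t| * ε')) := by
  have hVm := hV.aestronglyMeasurable
  have hc := abs_sub_exp_le_of_deriv_bound (φ := fun t => ∫ ω, Real.cos (t * V ω) ∂μ)
    (fun t => hasDerivAt_integral_comp_mul (f := Real.cos) (f' := fun t => -Real.sin t)
      Real.hasDerivAt_cos Real.continuous_sin.neg Real.abs_cos_le_one
      (fun t => by rw [abs_neg]; exact Real.abs_sin_le_one t) hV t) hv hε'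
    (fun t => by
      rw [← abs_neg]
      convert hsin t using 2
      simp only [mul_neg, integral_neg]; ring) t
  have hs := abs_sub_exp_le_of_deriv_bound (φ := fun t => ∫ ω, Real.sin (t * V ω) ∂μ)
    (fun t => hasDerivAt_integral_comp_mul (f := Real.sin) (f' := Real.cos)
      Real.hasDerivAt_sin Real.continuous_cos Real.abs_sin_le_one Real.abs_cos_le_one hV t)
    hv hε' hcos t
  simp only [zero_mul, Real.cos_zero, Real.sin_zero, integral_const, probReal_univ, smul_eq_mul,
    mul_one, one_mul, mul_zero, sub_zero] at hc hs
  have ic : Integrable (fun ω => Real.cos (t * V ω)) μ := Integrable.of_bound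
    (Real.continuous_cos.comp_aestronglyMeasurable (hVm.const_mul t)) 1
    (ae_of_all _ fun ω => Real.abs_cos_le_one _)
  have is : Integrable (fun ω => Real.sin (t * V ω)) μ := Integrable.of_bound
    (Real.continuous_sin.comp_aestronglyMeasurable (hVm.const_mul t)) 1
    (ae_of_all _ fun ω => Real.abs_sin_le_one _)
  have e : ∫ ω, Complex.exp (t * V ω * Complex.I) ∂μ =
      (∫ ω, Real.cos (t * V ω) ∂μ : ℝ) + (∫ ω, Real.sin (t * V ω) ∂μ : ℝ) * Complex.I := by
    rw [← integral_complex_ofReal, ← integral_complex_ofReal, ← integral_mul_const,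
      ← integral_add ic.ofReal (is.ofReal.mul_const _)]
    congr 1; ext ω
    rw [Complex.exp_mul_I]
    push_cast; rfl
  rw [e]
  calc _ = ‖((∫ ω, Real.cos (t * V ω) ∂μ - Real.exp (-(v * t ^ 2 / 2)) : ℝ) : ℂ) +
        ((∫ ω, Real.sin (t * V ω) ∂μ : ℝ) : ℂ) * Complex.I‖ := by
        congr 1; push_cast; ring
    _ ≤ |∫ ω, Real.cos (t * V ω) ∂μ - Real.exp (-(v * t ^ 2 / 2))| +
        |∫ ω, Real.sin (t * V ω) ∂μ| := by
        refine (norm_add_le _ _).trans ?_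
        rw [norm_mul, Complex.norm_I, mul_one, Complex.norm_real, Complex.norm_real,
          Real.norm_eq_abs, Real.norm_eq_abs]
    _ ≤ _ := by linarith

lemma norm_cexp_mul_I_sub_le (a b : ℝ) :
    ‖Complex.exp (a * Complex.I) - Complex.exp (b * Complex.I)‖ ≤ |a - b| := by
  have e : Complex.exp (a * Complex.I) - Complex.exp (b * Complex.I) =
      Complex.exp (b * Complex.I) * (Complex.exp (Complex.I * (a - b : ℝ)) - 1) := by
    rw [mul_sub, ← Complex.exp_add]
    push_cast
    ring_nf
  rw [e, norm_mul, Complex.norm_exp_ofReal_mul_I, one_mul]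
  exact Real.norm_exp_I_mul_ofReal_sub_one_le

/-- Comparison of characteristic functions of two variables that are close off an event; the event
enters through the function `B`, which is at least `2` on it. -/
lemma norm_integral_cexp_sub_integral_cexp_le {W U R B : Ω → ℝ} (hW : AEMeasurable W μ)
    (hU : AEMeasurable U μ) (hR : Integrable R μ) (hB : Integrable B μ) (hR0 : ∀ ω, 0 ≤ R ω)
    (hB0 : ∀ ω, 0 ≤ B ω) (h : ∀ ω, B ω < 2 → |W ω - U ω| ≤ R ω) (t : ℝ) :
    ‖∫ ω, Complex.exp (t * W ω * Complex.I) ∂μ - ∫ ω, Complex.exp (t * U ω * Complex.I) ∂μ‖ ≤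
      |t| * ∫ ω, R ω ∂μ + ∫ ω, B ω ∂μ := by
  have hi : ∀ {Y : Ω → ℝ}, AEMeasurable Y μ →
      Integrable (fun ω => Complex.exp (t * Y ω * Complex.I)) μ := by
    intro Y hY
    refine Integrable.of_bound (C := 1) ?_ (ae_of_all _ fun ω => ?_)
    · exact (Complex.measurable_exp.comp_aemeasurable
        (((Complex.measurable_ofReal.comp_aemeasurable hY).const_mul _).mul_const _)
        ).aestronglyMeasurable
    · rw [← Complex.ofReal_mul, Complex.norm_exp_ofReal_mul_I]
  rw [← integral_sub (hi hW) (hi hU), ← integral_const_mul, ← integral_add (hR.const_mul _) hB]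
  refine norm_integral_le_of_norm_le ((hR.const_mul _).add hB) (ae_of_all _ fun ω => ?_)
  have h1 := norm_cexp_mul_I_sub_le (t * W ω) (t * U ω)
  push_cast at h1
  by_cases hb : B ω < 2
  · refine h1.trans ?_
    rw [← mul_sub, abs_mul]
    have := mul_le_mul_of_nonneg_left (h ω hb) (abs_nonneg t)
    have := hB0 ω
    linarith
  · refine (norm_sub_le _ _).trans ?_
    rw [← Complex.ofReal_mul, ← Complex.ofReal_mul, Complex.norm_exp_ofReal_mul_I,
      Complex.norm_exp_ofReal_mul_I]
    have := mul_nonneg (abs_nonneg t) (hR0 ω)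
    linarith

end CharFun

/-! ### Expansion of the eigenvalue factor -/

section Expansion

variable {p q : ℕ}

/-- The recentred logarithm of the eigenvalue factor, as a function of the entries. -/
noncomputable def centredLogFactor (n : ℕ) (x : Fin p × Fin q → ℝ) : ℝ :=
  Real.log (eigenvalueFactor n (dataMatrix x)) - (p : ℝ) * q / 2
    + (p : ℝ) * q * ((q : ℝ) + 1) / (4 * ((n : ℝ) - p))

lemma measurable_dataMatrix_entry (i : Fin p) (j : Fin q) :
    Measurable (fun x => dataMatrix x i j) := measurable_pi_apply (i, j)

lemma measurable_det_of_entries {Ω m : Type*} [MeasurableSpace Ω] [Fintype m] [DecidableEq m]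
    {B : Ω → Matrix m m ℝ} (hB : ∀ i j, Measurable fun x => B x i j) :
    Measurable fun x => (B x).det := by
  simp only [Matrix.det_apply']
  exact Finset.measurable_fun_sum _ fun τ _ =>
    (Finset.measurable_fun_prod _ fun i _ => hB _ _).const_mul _

/-- The eigenvalues enter only through a determinant and a trace, which are polynomials in the
entries. -/
lemma measurable_centredLogFactor (n : ℕ) :
    Measurable (centredLogFactor n : (Fin p × Fin q → ℝ) → ℝ) := by
  have hdet : ∀ x : Fin p × Fin q → ℝ, ∏ i, (1 - gramEigenvalues (dataMatrix x) i / n) =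
      (1 - (n : ℝ)⁻¹ • ((dataMatrix x)ᵀ * dataMatrix x)).det := by
    intro x
    rw [Matrix.IsHermitian.det_one_sub_smul
      (by simpa using Matrix.isHermitian_conjTranspose_mul_self (dataMatrix x))]
    refine Finset.prod_congr rfl fun i _ => ?_
    rw [gramEigenvalues, inv_mul_eq_div]
  have htr : ∀ x : Fin p × Fin q → ℝ, ∑ i, gramEigenvalues (dataMatrix x) i =
      gramPowerTrace 1 x + p * q := by
    intro x
    rw [gramPowerTrace_eq_sum]
    simp [mul_comm]
  have hg : ∀ i j : Fin q, Measurable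
      (fun x : Fin p × Fin q → ℝ => ((dataMatrix x)ᵀ * dataMatrix x) i j) := by
    intro i j
    simp only [Matrix.mul_apply, Matrix.transpose_apply]
    exact Finset.measurable_fun_sum _ fun k _ =>
      (measurable_dataMatrix_entry k i).mul (measurable_dataMatrix_entry k j)
  have m1 : Measurable (fun x : Fin p × Fin q → ℝ => gramPowerTrace 1 x) := by
    have : ∀ x : Fin p × Fin q → ℝ, gramPowerTrace 1 x =
      ((dataMatrix x)ᵀ * dataMatrix x).trace - p * q := fun x => by rw [trace_gram]; ring
    simp only [this]
    exact (Finset.measurable_fun_sum _ fun i _ => hg i i).sub_const _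
  have m2 : Measurable (fun x : Fin p × Fin q → ℝ =>
      (1 - (n : ℝ)⁻¹ • ((dataMatrix x)ᵀ * dataMatrix x)).det) := by
    refine measurable_det_of_entries fun i j => ?_
    simp only [Matrix.sub_apply, Matrix.smul_apply, smul_eq_mul]
    exact ((hg i j).const_mul _).const_sub _
  unfold centredLogFactor eigenvalueFactor
  simp only [hdet, htr]
  exact (((Real.measurable_log.comp (((m2.pow_const _).const_mul _).mul
    (Real.measurable_exp.comp ((m1.add_const _).const_mul _)))).sub_const _).add_const _)

lemma abs_log_one_sub_add_le {y : ℝ} (hy : |y| ≤ 1 / 2) :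
    |Real.log (1 - y) + y + y ^ 2 / 2| ≤ 2 * |y| ^ 3 := by
  have h := Real.abs_log_sub_add_sum_range_le (x := y) (by linarith) 2
  simp only [Finset.sum_range_succ, Finset.sum_range_zero] at h
  norm_num at h
  calc |Real.log (1 - y) + y + y ^ 2 / 2| = |y + y ^ 2 / 2 + Real.log (1 - y)| := by
        congr 1; ring
    _ ≤ |y| ^ 3 / (1 - |y|) := h
    _ ≤ 2 * |y| ^ 3 := by
        rw [div_le_iff₀ (by linarith)]
        nlinarith [pow_nonneg (abs_nonneg y) 3]

/-- Second-order expansion of the logarithm of the eigenvalue factor around `λᵢ = p`: on the event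
`tr A² ≤ (n - p)² / 4` all eigenvalues satisfy `|λᵢ - p| ≤ (n - p) / 2`. -/
lemma abs_centredLogFactor_add_le {n : ℕ} (hn : p + q + 1 ≤ n) {s : ℝ} (hs : 0 < s)
    (x : Fin p × Fin q → ℝ) (hx : gramPowerTrace 2 x ≤ ((n : ℝ) - p) ^ 2 / 4) :
    |centredLogFactor n x - -((gramPowerTrace 2 x - p * q * (q + 1)) / (n - p)) / 4| ≤
      (q + 1) / (2 * (n - p)) * |gramPowerTrace 1 x| +
      1 / (n - p) ^ 2 * ((s * gramPowerTrace 2 x + gramPowerTrace 4 x / s) / 2) +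
      (q + 1) / (4 * (n - p) ^ 2) * gramPowerTrace 2 x := by
  have hn' : (p : ℝ) + q + 1 ≤ n := by exact_mod_cast hn
  have hp0 : (0 : ℝ) ≤ p := by positivity
  have hq0 : (0 : ℝ) ≤ q := by positivity
  obtain ⟨N, hN⟩ : ∃ N : ℝ, N = n - p := ⟨_, rfl⟩
  rw [← hN] at hx ⊢
  have hNpos : 0 < N := by linarith
  have hnpos : (0 : ℝ) < n := by linarith
  set l := gramEigenvalues (dataMatrix x) with hl
  set y : Fin q → ℝ := fun i => (l i - p) / N with hy
  have hT1 : gramPowerTrace 1 x = N * ∑ i, y i := by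
    rw [gramPowerTrace_eq_sum, Finset.mul_sum]
    refine Finset.sum_congr rfl fun i _ => ?_
    simp only [hy]; field_simp; rfl
  have hT2 : gramPowerTrace 2 x = N ^ 2 * ∑ i, y i ^ 2 := by
    rw [gramPowerTrace_eq_sum, Finset.mul_sum]
    refine Finset.sum_congr rfl fun i _ => ?_
    simp only [hy]; field_simp; rfl
  have hT3 : ∑ i, |l i - p| ^ 3 = N ^ 3 * ∑ i, |y i| ^ 3 := by
    rw [Finset.mul_sum]
    refine Finset.sum_congr rfl fun i _ => ?_
    simp only [hy]; rw [abs_div, abs_of_pos hNpos]; field_simp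
  have hsum2 : ∑ i, y i ^ 2 ≤ 1 / 4 := by
    rw [hT2] at hx
    have : N ^ 2 * ∑ i, y i ^ 2 ≤ N ^ 2 * (1 / 4) := by linarith
    exact le_of_mul_le_mul_left this (by positivity)
  have hyi : ∀ i, |y i| ≤ 1 / 2 := by
    intro i
    have h1 : y i ^ 2 ≤ 1 / 4 :=
      (Finset.single_le_sum (f := fun i => y i ^ 2) (fun _ _ => sq_nonneg _)
        (Finset.mem_univ i)).trans hsum2
    exact abs_le_of_sq_le_sq (by linarith : y i ^ 2 ≤ (1 / 2) ^ 2) (by norm_num)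
  -- the factors `1 - p / n` cancel against the prefactor, and only the `1 - y i` remain
  have hfac : ∀ i, 1 - l i / n = (1 - p / n) * (1 - y i) := by
    intro i
    simp only [hy]
    have : (n : ℝ) = N + p := by linarith
    field_simp
    rw [this]; ring
  have hpn : 0 < 1 - (p : ℝ) / n := by
    rw [sub_pos, div_lt_one hnpos]; linarith
  have hyp : ∀ i, 0 < 1 - y i := fun i => by
    have := (abs_le.1 (hyi i)).2; linarith
  obtain ⟨m, hm⟩ : ∃ m : ℝ, m = (n : ℝ) - p - q - 1 := ⟨_, rfl⟩
  have hlog : Real.log (eigenvalueFactor n (dataMatrix x)) =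
      m / 2 * ∑ i, Real.log (1 - y i) + 1 / 2 * (gramPowerTrace 1 x + p * q) := by
    have hprod : 0 < ∏ i, (1 - l i / n) :=
      Finset.prod_pos fun i _ => by rw [hfac]; exact mul_pos hpn (hyp i)
    have htr : ∑ i, l i = gramPowerTrace 1 x + p * q := by
      rw [gramPowerTrace_eq_sum]
      simp [hl, mul_comm]
    rw [eigenvalueFactor, ← hl, ← hm, Real.log_mul (mul_pos (Real.rpow_pos_of_pos hpn _)
      (Real.rpow_pos_of_pos hprod _)).ne' (Real.exp_pos _).ne', Real.log_mul
      (Real.rpow_pos_of_pos hpn _).ne' (Real.rpow_pos_of_pos hprod _).ne', Real.log_exp,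
      Real.log_rpow hpn, Real.log_rpow hprod, Real.log_prod
      (fun i _ => by rw [hfac]; exact (mul_pos hpn (hyp i)).ne'), htr]
    have : ∀ i, Real.log (1 - l i / n) = Real.log (1 - p / n) + Real.log (1 - y i) := fun i => by
      rw [hfac, Real.log_mul hpn.ne' (hyp i).ne']
    simp only [this, Finset.sum_add_distrib, Finset.sum_const, Finset.card_univ, Fintype.card_fin,
      nsmul_eq_mul]
    ring
  have hrem : |∑ i, Real.log (1 - y i) + ∑ i, y i + (∑ i, y i ^ 2) / 2| ≤
      2 * ∑ i, |y i| ^ 3 := by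
    rw [Finset.sum_div, ← Finset.sum_add_distrib, ← Finset.sum_add_distrib, Finset.mul_sum]
    exact (Finset.abs_sum_le_sum_abs _ _).trans
      (Finset.sum_le_sum fun i _ => abs_log_one_sub_add_le (hyi i))
  have hm0 : 0 ≤ m := by linarith
  have hmN : m ≤ N := by linarith
  have hmq : m = N - (q + 1) := by rw [hm, hN]; ring
  have hid : centredLogFactor n x - -((gramPowerTrace 2 x - p * q * (q + 1)) / N) / 4 =
      (q + 1) / (2 * N) * gramPowerTrace 1 x +
      m / 2 * (∑ i, Real.log (1 - y i) + ∑ i, y i + (∑ i, y i ^ 2) / 2) +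
      (q + 1) / (4 * N ^ 2) * gramPowerTrace 2 x := by
    rw [centredLogFactor, hlog, ← hN, hT1, hT2, hmq]
    field_simp
    ring
  rw [hid]
  have hcub := sum_abs_pow_three_le hs x
  rw [← hl, hT3] at hcub
  have hmid : |m / 2 * (∑ i, Real.log (1 - y i) + ∑ i, y i + (∑ i, y i ^ 2) / 2)| ≤
      1 / N ^ 2 * ((s * gramPowerTrace 2 x + gramPowerTrace 4 x / s) / 2) := by
    rw [abs_mul, abs_of_nonneg (by linarith : 0 ≤ m / 2)]
    calc m / 2 * |∑ i, Real.log (1 - y i) + ∑ i, y i + (∑ i, y i ^ 2) / 2|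
        ≤ N / 2 * (2 * ∑ i, |y i| ^ 3) := by gcongr
      _ = 1 / N ^ 2 * (N ^ 3 * ∑ i, |y i| ^ 3) := by field_simp
      _ ≤ _ := by gcongr
  refine (abs_add_le _ _).trans (add_le_add ((abs_add_le _ _).trans (add_le_add ?_ hmid)) ?_)
  · rw [abs_mul, abs_of_nonneg (by positivity)]
  · rw [abs_of_nonneg (mul_nonneg (by positivity) (gramPowerTrace_two_nonneg x))]

end Expansion

/-! ### Limit of the characteristic functions -/

section Limit

variable {p q : ℕ}

/-- The characteristic function of `(tr A² - pq(q+1)) / N` is close to that of a centred Gaussian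
of variance `4p · pq(q+1) / N²`. -/
lemma norm_charFun_gramPowerTrace_two_sub_le (hq : 1 ≤ q) (hqp : q ≤ p) {s N : ℝ} (hs : 0 < s)
    (hs2 : s ^ 2 = p * q) (hN : 0 < N) (t : ℝ) :
    ‖∫ x, Complex.exp (t * ((gramPowerTrace 2 x - p * q * (q + 1)) / N : ℝ) * Complex.I)
        ∂gaussianMatrix p q -
      (Real.exp (-(4 * p * (p * q * (q + 1)) / N ^ 2 * t ^ 2 / 2)) : ℂ)‖ ≤
    2 * (|t| * (3 / 2 * (q + 1) * s / N + |t| *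
      (4 * (225 * p * s ^ 2 + 53 * s ^ 3 * q) / N ^ 2))) := by
  have hT := hasAllMoments_gramPowerTrace (p := p) (q := q)
  set c : ℝ := p * q * (q + 1) with hc
  have hV : HasAllMoments (fun x => (gramPowerTrace 2 x - c) / N) (gaussianMatrix p q) := by
    simpa only [div_eq_inv_mul] using ((hT 2).sub (.const c)).const_mul N⁻¹
  have hlin : ∀ t y : ℝ, HasDerivAt (fun y => t * ((y - c) / N)) (t / N) y := by
    intro t y
    have := (((hasDerivAt_id y).sub_const c).div_const N).const_mul t
    convert! this using 1
    ring
  have hb : ∀ t y : ℝ, |y| ≤ 1 → |y * (t / N)| ≤ |t| / N := fun t y hy => by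
    rw [abs_mul, abs_div, abs_of_pos hN]
    exact mul_le_of_le_one_left (by positivity) hy
  refine norm_integral_cexp_sub_le hV.integrable (by positivity) (by positivity) ?_ ?_ t
  · intro t
    have h := abs_integral_stein_le hq hqp hs hs2
      (f := fun y => Real.sin (t * ((y - c) / N)))
      (f' := fun y => Real.cos (t * ((y - c) / N)) * (t / N))
      (fun y => (hlin t y).sin) (by fun_prop) (K := |t| / N)
      (fun y => Real.abs_sin_le_one _) (fun y => hb t _ (Real.abs_cos_le_one _))
    rw [← hc] at h
    have e : ∫ x, (gramPowerTrace 2 x - c) / N * Real.sin (t * ((gramPowerTrace 2 x - c) / N))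
          ∂gaussianMatrix p q - 4 * p * c / N ^ 2 * t *
          ∫ x, Real.cos (t * ((gramPowerTrace 2 x - c) / N)) ∂gaussianMatrix p q =
        (∫ x, (gramPowerTrace 2 x - c) * Real.sin (t * ((gramPowerTrace 2 x - c) / N))
          ∂gaussianMatrix p q - 4 * p * c *
          ∫ x, Real.cos (t * ((gramPowerTrace 2 x - c) / N)) * (t / N)
            ∂gaussianMatrix p q) / N := by
      have k : ∫ x, (gramPowerTrace 2 x - c) / N *
            Real.sin (t * ((gramPowerTrace 2 x - c) / N)) ∂gaussianMatrix p q =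
          (∫ x, (gramPowerTrace 2 x - c) * Real.sin (t * ((gramPowerTrace 2 x - c) / N))
            ∂gaussianMatrix p q) / N := by
        rw [← integral_div]
        congr 1; ext x; ring
      rw [k, integral_mul_const]
      ring
    rw [e, abs_div, abs_of_pos hN]
    calc _ ≤ (3 / 2 * (q + 1) * s + 4 * (225 * p * s ^ 2 + 53 * s ^ 3 * q) * (|t| / N)) / N := by
          gcongr
      _ = _ := by field_simp
  · intro t
    have h := abs_integral_stein_le hq hqp hs hs2
      (f := fun y => Real.cos (t * ((y - c) / N)))
      (f' := fun y => -Real.sin (t * ((y - c) / N)) * (t / N))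
      (fun y => (hlin t y).cos) (by fun_prop) (K := |t| / N)
      (fun y => Real.abs_cos_le_one _)
      (fun y => hb t _ (by rw [abs_neg]; exact Real.abs_sin_le_one _))
    rw [← hc] at h
    have e : ∫ x, (gramPowerTrace 2 x - c) / N * Real.cos (t * ((gramPowerTrace 2 x - c) / N))
          ∂gaussianMatrix p q + 4 * p * c / N ^ 2 * t *
          ∫ x, Real.sin (t * ((gramPowerTrace 2 x - c) / N)) ∂gaussianMatrix p q =
        (∫ x, (gramPowerTrace 2 x - c) * Real.cos (t * ((gramPowerTrace 2 x - c) / N))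
          ∂gaussianMatrix p q - 4 * p * c *
          ∫ x, -Real.sin (t * ((gramPowerTrace 2 x - c) / N)) * (t / N)
            ∂gaussianMatrix p q) / N := by
      have k : ∫ x, (gramPowerTrace 2 x - c) / N *
            Real.cos (t * ((gramPowerTrace 2 x - c) / N)) ∂gaussianMatrix p q =
          (∫ x, (gramPowerTrace 2 x - c) * Real.cos (t * ((gramPowerTrace 2 x - c) / N))
            ∂gaussianMatrix p q) / N := by
        rw [← integral_div]
        congr 1; ext x; ring
      rw [k, integral_mul_const, integral_neg]
      ring
    rw [e, abs_div, abs_of_pos hN]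
    calc _ ≤ (3 / 2 * (q + 1) * s + 4 * (225 * p * s ^ 2 + 53 * s ^ 3 * q) * (|t| / N)) / N := by
          gcongr
      _ = _ := by field_simp

/-- The characteristic function of the recentred logarithm of the eigenvalue factor is close to a
Gaussian one, with an error in terms of `u = pq/N`, `w = (q+1)√(pq)/N`, `r = p/N` and
`b = (q+1)/N`, where `N = n - p`. -/
lemma norm_charFun_centredLogFactor_sub_le {n : ℕ} (hq : 1 ≤ q) (hqp : q ≤ p) (hn : p + q + 1 ≤ n)
    {s N u w r b : ℝ} (hs : 0 < s) (hs2 : s ^ 2 = p * q) (hN : N = n - p) (hu : u = p * q / N)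
    (hw : w = (q + 1) * s / N) (hr : r = p / N) (hb : b = (q + 1) / N) (t : ℝ) :
    ‖∫ x, Complex.exp (t * (centredLogFactor n x : ℝ) * Complex.I) ∂gaussianMatrix p q -
      (Real.exp (-(u ^ 2 * ((q + 1) / q) * t ^ 2 / 8)) : ℂ)‖ ≤
    |t| * (3 / 4 * w + 53 * (u * w) + w ^ 2 / 4) + 8 * (u * b) +
      |t| / 2 * (3 / 2 * w + |t| * (225 * (r * u) + 53 * (u * w))) := by
  have hT := hasAllMoments_gramPowerTrace (p := p) (q := q)
  have hn' : (p : ℝ) + q + 1 ≤ n := by exact_mod_cast hn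
  have hq0 : (0 : ℝ) < q := by exact_mod_cast hq
  have hNpos : 0 < N := by linarith
  set c : ℝ := p * q * (q + 1) with hc
  set R : (Fin p × Fin q → ℝ) → ℝ := fun x => (q + 1) / (2 * N) * |gramPowerTrace 1 x| +
      1 / N ^ 2 * ((s * gramPowerTrace 2 x + gramPowerTrace 4 x / s) / 2) +
      (q + 1) / (4 * N ^ 2) * gramPowerTrace 2 x with hR
  -- `B < 2` is the event `tr A² < N² / 4` on which the expansion is valid
  set B : (Fin p × Fin q → ℝ) → ℝ := fun x => 8 / N ^ 2 * gramPowerTrace 2 x with hB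
  have i24 : Integrable (fun x => (s * gramPowerTrace 2 x + gramPowerTrace 4 x / s) / 2)
      (gaussianMatrix p q) :=
    (((hT 2).const_mul s).integrable.add ((hT 4).integrable.div_const s)).div_const 2
  have i12 : Integrable (fun x => (q + 1) / (2 * N) * |gramPowerTrace 1 x| +
      1 / N ^ 2 * ((s * gramPowerTrace 2 x + gramPowerTrace 4 x / s) / 2))
      (gaussianMatrix p q) :=
    ((hT 1).abs.const_mul _).integrable.add (i24.const_mul _)
  have iR : Integrable R (gaussianMatrix p q) := i12.add ((hT 2).const_mul _).integrable
  have iB : Integrable B (gaussianMatrix p q) := ((hT 2).const_mul _).integrable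
  have hR0 : ∀ x, 0 ≤ R x := fun x => by
    have h2 := gramPowerTrace_two_nonneg x
    have h4 := gramPowerTrace_four_nonneg x
    simp only [hR]; positivity
  have hB0 : ∀ x, 0 ≤ B x := fun x => by
    have h2 := gramPowerTrace_two_nonneg x
    simp only [hB]; positivity
  have hcmp := norm_integral_cexp_sub_integral_cexp_le (μ := gaussianMatrix p q)
    (W := centredLogFactor n) (U := fun x => -((gramPowerTrace 2 x - c) / N) / 4) (R := R) (B := B)
    (measurable_centredLogFactor n).aemeasurable
    ((((hT 2).sub (.const c)).integrable.div_const N).neg.div_const 4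
      ).aestronglyMeasurable.aemeasurable
    iR iB hR0 hB0 (fun x hx => by
      have := abs_centredLogFactor_add_le hn hs x (by
        rw [← hN]
        simp only [hB] at hx
        rw [div_mul_eq_mul_div, div_lt_iff₀ (by positivity)] at hx
        linarith)
      rw [← hN] at this
      exact this) t
  have hst := norm_charFun_gramPowerTrace_two_sub_le hq hqp hs hs2 hNpos (-t / 4)
  rw [← hc] at hst
  have e1 : ∀ x : Fin p × Fin q → ℝ,
      Complex.exp (t * (-((gramPowerTrace 2 x - c) / N) / 4 : ℝ) * Complex.I) =
      Complex.exp ((-t / 4 : ℝ) * ((gramPowerTrace 2 x - c) / N : ℝ) * Complex.I) := by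
    intro x; congr 1; push_cast; ring
  simp only [e1] at hcmp
  have e2 : 4 * p * c / N ^ 2 * (-t / 4) ^ 2 / 2 = u ^ 2 * ((q + 1) / q) * t ^ 2 / 8 := by
    rw [hc, hu]; field_simp; ring
  rw [e2] at hst
  have hIR : ∫ x, R x ∂gaussianMatrix p q ≤ 3 / 4 * w + 53 * (u * w) + w ^ 2 / 4 := by
    simp only [hR]
    rw [integral_add i12 ((hT 2).const_mul _).integrable,
      integral_add ((hT 1).abs.const_mul _).integrable (i24.const_mul _), integral_const_mul,
      integral_const_mul, integral_const_mul, integral_gramPowerTrace_two]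
    refine add_le_add (add_le_add ?_ ?_) (le_of_eq ?_)
    · calc _ ≤ (q + 1) / (2 * N) * (3 / 2 * s) := by
            gcongr; exact integral_abs_gramPowerTrace_one_le hs hs2
        _ = _ := by rw [hw]; field_simp; ring
    · calc _ ≤ 1 / N ^ 2 * (53 * s ^ 3 * (q + 1)) := by
            gcongr
            refine (integral_cubic_bound_le hq hqp hs hs2).trans ?_
            gcongr; linarith
        _ = _ := by rw [hu, hw, ← hs2]; field_simp
    · rw [hw, div_pow, mul_pow, hs2]; field_simp
  have hIB : ∫ x, B x ∂gaussianMatrix p q = 8 * (u * b) := by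
    simp only [hB]
    rw [integral_const_mul, integral_gramPowerTrace_two, hu, hb]; field_simp
  have hE : 2 * (|-t / 4| * (3 / 2 * (q + 1) * s / N + |-t / 4| *
      (4 * (225 * p * s ^ 2 + 53 * s ^ 3 * q) / N ^ 2))) ≤
      |t| / 2 * (3 / 2 * w + |t| * (225 * (r * u) + 53 * (u * w))) := by
    have ha : |-t / 4| = |t| / 4 := by rw [abs_div, abs_neg]; norm_num
    rw [ha]
    calc _ ≤ 2 * (|t| / 4 * (3 / 2 * (q + 1) * s / N + |t| / 4 *
          (4 * (225 * p * s ^ 2 + 53 * s ^ 3 * (q + 1)) / N ^ 2))) := by gcongr; linarith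
      _ = _ := by rw [hw, hr, hu, ← hs2]; field_simp; ring
  calc _ ≤ ‖∫ x, Complex.exp (t * (centredLogFactor n x : ℝ) * Complex.I) ∂gaussianMatrix p q -
        ∫ x, Complex.exp ((-t / 4 : ℝ) * ((gramPowerTrace 2 x - c) / N : ℝ) * Complex.I)
          ∂gaussianMatrix p q‖ +
        ‖∫ x, Complex.exp ((-t / 4 : ℝ) * ((gramPowerTrace 2 x - c) / N : ℝ) * Complex.I)
          ∂gaussianMatrix p q - (Real.exp (-(u ^ 2 * ((q + 1) / q) * t ^ 2 / 8)) : ℂ)‖ :=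
        norm_sub_le_norm_sub_add_norm_sub _ _ _
    _ ≤ (|t| * (3 / 4 * w + 53 * (u * w) + w ^ 2 / 4) + 8 * (u * b)) +
        |t| / 2 * (3 / 2 * w + |t| * (225 * (r * u) + 53 * (u * w))) := by
        refine add_le_add (hcmp.trans ?_) (hst.trans hE)
        rw [hIB]
        gcongr

end Limit

section Asymptotics

variable {p q : ℕ → ℕ} {σ : ℝ}

lemma tendsto_charFun_centredLogFactor (hσ : 0 < σ) (hq : Tendsto q atTop atTop)
    (hqp : Tendsto (fun n => (q n : ℝ) / (p n : ℝ)) atTop (nhds 0))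
    (hpq : Tendsto (fun n => (p n : ℝ) * (q n : ℝ) / (n : ℝ)) atTop (nhds σ)) (t : ℝ) :
    Tendsto (fun n => ∫ x, Complex.exp (t * (centredLogFactor n x : ℝ) * Complex.I)
      ∂gaussianMatrix (p n) (q n)) atTop (nhds (Real.exp (-(σ ^ 2 * t ^ 2 / 8)) : ℂ)) := by
  have hqR : Tendsto (fun n => (q n : ℝ)) atTop atTop := tendsto_natCast_atTop_atTop.comp hq
  have hqinv : Tendsto (fun n => (q n : ℝ)⁻¹) atTop (nhds 0) := tendsto_inv_atTop_zero.comp hqR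
  have evq : ∀ᶠ n in atTop, 1 ≤ q n := hq.eventually_ge_atTop 1
  have evn : ∀ᶠ n : ℕ in atTop, 1 ≤ n := eventually_ge_atTop 1
  -- `p n ≠ 0` because otherwise `pq/n = 0`, which is far from `σ`
  have evp : ∀ᶠ n in atTop, 0 < p n := by
    filter_upwards [hpq.eventually (lt_mem_nhds hσ)] with n hn
    rcases Nat.eq_zero_or_pos (p n) with h | h
    · simp [h] at hn
    · exact h
  have evqp : ∀ᶠ n in atTop, q n ≤ p n := by
    filter_upwards [hqp.eventually (gt_mem_nhds one_pos), evp] with n hn hp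
    have hp' : (0 : ℝ) < p n := by exact_mod_cast hp
    rw [div_lt_one hp'] at hn
    exact_mod_cast hn.le
  have hpn : Tendsto (fun n => (p n : ℝ) / n) atTop (nhds 0) := by
    have := hpq.mul hqinv
    rw [mul_zero] at this
    refine this.congr' ?_
    filter_upwards [evq, evn] with n h1 h2
    have : (0 : ℝ) < q n := by exact_mod_cast h1
    have : (0 : ℝ) < n := by exact_mod_cast h2
    field_simp
  have evN : ∀ᶠ n in atTop, p n + q n + 1 ≤ n := by
    filter_upwards [hpn.eventually (gt_mem_nhds (by norm_num : (0 : ℝ) < 1 / 3)), evn, evqp, evp]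
      with n h1 h2 h3 h4
    have : (0 : ℝ) < n := by exact_mod_cast h2
    rw [div_lt_iff₀ this] at h1
    have : (3 * p n : ℝ) < n := by linarith
    have : 3 * p n < n := by exact_mod_cast this
    omega
  have hnN : Tendsto (fun n : ℕ => (n : ℝ) / (n - p n)) atTop (nhds 1) := by
    have : Tendsto (fun n : ℕ => (1 - (p n : ℝ) / n)⁻¹) atTop (nhds 1) := by
      simpa using (hpn.const_sub 1).inv₀ (by norm_num)
    refine this.congr' ?_
    filter_upwards [evN] with n h1
    have h1' : (p n + q n + 1 : ℝ) ≤ n := by exact_mod_cast h1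
    have hq0 : (0 : ℝ) ≤ q n := by positivity
    have hp0 : (0 : ℝ) ≤ p n := by positivity
    have hn0 : (0 : ℝ) < n := by linarith
    rw [one_sub_div hn0.ne', inv_div]
  have hu : Tendsto (fun n => (p n : ℝ) * q n / (n - p n)) atTop (nhds σ) := by
    have := hpq.mul hnN
    rw [mul_one] at this
    refine this.congr' ?_
    filter_upwards [evn] with n h1
    have hn0 : (0 : ℝ) < n := by exact_mod_cast h1
    rw [div_mul_div_cancel₀ hn0.ne']
  have hk : Tendsto (fun n => ((q n : ℝ) + 1) / q n) atTop (nhds 1) := by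
    have : Tendsto (fun n => 1 + (q n : ℝ)⁻¹) atTop (nhds 1) := by
      simpa using hqinv.const_add 1
    refine this.congr' ?_
    filter_upwards [evq] with n h1
    have : (0 : ℝ) < q n := by exact_mod_cast h1
    field_simp
  have hr : Tendsto (fun n => (p n : ℝ) / (n - p n)) atTop (nhds 0) := by
    have := hu.mul hqinv
    rw [mul_zero] at this
    refine this.congr' ?_
    filter_upwards [evq] with n h1
    have : (0 : ℝ) < q n := by exact_mod_cast h1
    field_simp
  have hb : Tendsto (fun n => ((q n : ℝ) + 1) / (n - p n)) atTop (nhds 0) := by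
    have := (hk.mul hqp).mul hr
    rw [mul_zero] at this
    refine this.congr' ?_
    filter_upwards [evq, evp] with n h1 h2
    have : (0 : ℝ) < q n := by exact_mod_cast h1
    have : (0 : ℝ) < p n := by exact_mod_cast h2
    field_simp
  -- `w² = ((q+1)/q)² u² (q/p)`
  have hw : Tendsto (fun n => ((q n : ℝ) + 1) * √(p n * q n) / (n - p n)) atTop (nhds 0) := by
    have := (((hk.pow 2).mul (hu.pow 2)).mul hqp).sqrt
    rw [mul_zero, Real.sqrt_zero] at this
    refine this.congr' ?_
    filter_upwards [evq, evp, evN] with n h1 h2 h3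
    have hq0 : (0 : ℝ) < q n := by exact_mod_cast h1
    have hp0 : (0 : ℝ) < p n := by exact_mod_cast h2
    have h3' : (p n + q n + 1 : ℝ) ≤ n := by exact_mod_cast h3
    have hN0 : (0 : ℝ) < n - p n := by linarith
    have e : (((q n : ℝ) + 1) * √(p n * q n) / (n - p n)) ^ 2 =
        ((q n : ℝ) + 1) ^ 2 * (p n * q n) / (n - p n) ^ 2 := by
      rw [div_pow, mul_pow, Real.sq_sqrt (by positivity)]
    rw [Real.sqrt_eq_iff_mul_self_eq (by positivity) (by positivity), ← pow_two, e]
    field_simp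
  have hgauss : Tendsto (fun n => (Real.exp (-(((p n : ℝ) * q n / (n - p n)) ^ 2 *
      ((q n + 1) / q n) * t ^ 2 / 8)) : ℂ)) atTop
      (nhds (Real.exp (-(σ ^ 2 * t ^ 2 / 8)) : ℂ)) := by
    refine (Complex.continuous_ofReal.tendsto _).comp ((Real.continuous_exp.tendsto _).comp ?_)
    simpa using ((((hu.pow 2).mul hk).mul_const (t ^ 2)).div_const 8).neg
  have herr := ((((hw.const_mul (3 / 4)).add ((hu.mul hw).const_mul 53)).add
      ((hw.pow 2).div_const 4)).const_mul |t|).add ((hu.mul hb).const_mul 8) |>.add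
    (((hw.const_mul (3 / 2)).add ((((hr.mul hu).const_mul 225).add
      ((hu.mul hw).const_mul 53)).const_mul |t|)).const_mul (|t| / 2))
  have hdiff := squeeze_zero_norm' (a := fun n : ℕ => _) (f := fun n =>
      ∫ x, Complex.exp (t * (centredLogFactor n x : ℝ) * Complex.I) ∂gaussianMatrix (p n) (q n) -
      (Real.exp (-(((p n : ℝ) * q n / (n - p n)) ^ 2 * ((q n + 1) / q n) * t ^ 2 / 8)) : ℂ))
    (t₀ := atTop) (by
      filter_upwards [evq, evqp, evN, evp] with n h1 h2 h3 h4
      have hq0 : (0 : ℝ) < q n := by exact_mod_cast h1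
      have hp0 : (0 : ℝ) < p n := by exact_mod_cast h4
      exact norm_charFun_centredLogFactor_sub_le h1 h2 h3 (s := √(p n * q n)) (by positivity)
        (Real.sq_sqrt (by positivity)) rfl rfl rfl rfl rfl t)
    (by simpa using herr)
  simpa using hdiff.add hgauss

end Asymptotics

theorem mainTheorem5 {p q : ℕ → ℕ} {σ : ℝ} (hσ : 0 < σ)
    (hq : Tendsto q atTop atTop)
    (hqp : Tendsto (fun n => (q n : ℝ) / (p n : ℝ)) atTop (nhds 0))
    (hpq : Tendsto (fun n => (p n : ℝ) * (q n : ℝ) / (n : ℝ)) atTop (nhds σ))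
    {Ω : ℕ → Type*} [∀ n, MeasurableSpace (Ω n)]
    (P : ∀ n, Measure (Ω n)) [∀ n, IsProbabilityMeasure (P n)]
    (X : ∀ n, Ω n → Matrix (Fin (p n)) (Fin (q n)) ℝ)
    (hX : ∀ n, IsStandardGaussianMatrix (X n) (P n)) :
    TendstoInDistribution
      (fun n ω => Real.log (eigenvalueFactor n (X n ω)) - (p n : ℝ) * (q n : ℝ) / 2
        + (p n : ℝ) * (q n : ℝ) * ((q n : ℝ) + 1) / (4 * ((n : ℝ) - (p n : ℝ))))
      atTop (id : ℝ → ℝ) P (gaussianReal 0 (Real.toNNReal (σ ^ 2 / 4))) := by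
  set x : ∀ n, Ω n → Fin (p n) × Fin (q n) → ℝ := fun n ω ij => X n ω ij.1 ij.2 with hx
  have hxm : ∀ n, AEMeasurable (x n) (P n) := fun n =>
    aemeasurable_pi_lambda _ fun ij => ((hX n).hasLaw ij.1 ij.2).aemeasurable
  have hlaw : ∀ n, (P n).map (x n) = gaussianMatrix (p n) (q n) := fun n => by
    refine (iIndepFun.map_fun_eq_pi_map
      (f := fun (ij : Fin (p n) × Fin (q n)) ω => X n ω ij.1 ij.2)
      (fun ij => ((hX n).hasLaw ij.1 ij.2).aemeasurable) (hX n).indep).trans ?_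
    rw [gaussianMatrix]
    congr 1; ext1 ij
    exact ((hX n).hasLaw ij.1 ij.2).map_eq
  have hW : (fun n ω => Real.log (eigenvalueFactor n (X n ω)) - (p n : ℝ) * (q n : ℝ) / 2
        + (p n : ℝ) * (q n : ℝ) * ((q n : ℝ) + 1) / (4 * ((n : ℝ) - (p n : ℝ)))) =
      fun n ω => centredLogFactor n (x n ω) := rfl
  have hm : ∀ n, AEMeasurable (fun ω => centredLogFactor n (x n ω)) (P n) := fun n =>
    (measurable_centredLogFactor n).comp_aemeasurable (hxm n)
  rw [hW]
  refine ⟨hm, aemeasurable_id, ?_⟩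
  refine ProbabilityMeasure.tendsto_iff_tendsto_charFun.2 fun t => ?_
  have hlim : charFun ((gaussianReal 0 (Real.toNNReal (σ ^ 2 / 4))).map id) t =
      (Real.exp (-(σ ^ 2 * t ^ 2 / 8)) : ℂ) := by
    rw [Measure.map_id, charFun_gaussianReal, Real.coe_toNNReal _ (by positivity)]
    push_cast
    congr 1; ring
  have hchar : ∀ n, charFun ((P n).map fun ω => centredLogFactor n (x n ω)) t =
      ∫ y, Complex.exp (t * (centredLogFactor n y : ℝ) * Complex.I)
        ∂gaussianMatrix (p n) (q n) := by
    intro n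
    have hc := (measurable_centredLogFactor (p := p n) (q := q n) n)
    rw [charFun_apply_real, integral_map (hm n) (by fun_prop), ← hlaw n,
      integral_map (hxm n)]
    exact (Complex.measurable_exp.comp
      (((Complex.measurable_ofReal.comp hc).const_mul _).mul_const _)).aestronglyMeasurable
  simp only [ProbabilityMeasure.coe_mk, hlim, hchar]
  exact tendsto_charFun_centredLogFactor hσ hq hqp hpq t
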